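/- Setting. Let $A\in\mathbb R^{n\times n}$, $B\in\mathbb R^{n\times m}$ with $(A,B)$ controllable, $Q\succeq 0$, $R\succ 0$, let $P\succeq 0$ be a solution of the discrete-time algebraic Riccati equation $P=A^\top\big(P-PB(R+B^\top PB)^{-1}B^\top P\big)A+Q$, and let $K=-(B^\top PB+R)^{-1}B^\top PA$. Let $\mathcal X\subset\mathbb R^n$ and $\mathcal U\subset\mathbb R^m$ be compact polytopes with the origin in their interiors, let $\mathcal X_{\mathcal U}=\{\xi\in\mathcal X: K\xi\in\mathcal U\}$ and $\mathcal T=\{\xi\in\mathcal X: (A+BK)^k\xi\in\mathcal X_{\mathcal U}\text{ for all }k\ge 0\}$. The sets $\mathcal X$, $\mathcal U$, $\mathcal T$ are given by finitely many linear inequalities with nonzero normals. For a horizon $N\ge 0$ and an initial state $x(0)$ consider the problem $$\min_{u(0),\dots,u(N-1)}\ \tfrac12 x(N)^\top Px(N)+\tfrac12\sum_{k=0}^{N-1}\big(x(k)^\top Qx(k)+u(k)^\top Ru(k)\big)$$ subject to $x(k+1)=Ax(k)+Bu(k)$, $u(k)\in\mathcal U$, $x(k)\in\mathcal X$ for $k=0,\dots,N-1$,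 and $x(N)\in\mathcal T$. Let $\mathcal F_N$ be the set of the $x(0)$ for which it has a solution. The optimal inputs $u^\star(k)$ and states $x^\star(k)$ are extended to all $k\ge N$ by $u^\star(k)=Kx^\star(k)$, $x^\star(k+1)=(A+BK)x^\star(k)$. The active set of $x(0)\in\mathcal F_N$ is the set of those inequality constraints (the inequalities of $\mathcal X$ and $\mathcal U$ in the stages $0,\dots,N-1$ and those of $\mathcal T$ in stage $N$) that hold with equality at the optimal solution; $\mathcal A$ is an active set for horizon $N$ if it is the active set of some $x(0)\in\mathcal F_N$. The polytope $\mathcal P_N(\mathcal A)$ is the relative interior of the set of the $x(0)$ for which the Karush–Kuhn–Tucker conditions, with the constraints in $\mathcal A$ imposed as equalities and with multipliers that are nonnegative on $\mathcal A$ and zero off $\mathcal A$, have a solution. An active set $\mathcal A$ for horizon $N$ and $\mathcal P=\mathcal P_N(\mathcal A)$ are called persistent if for every $l\ge 0$ there is an active set $\mathcal A'$ for horizon $N+l$ with $\mathcal P_{N+l}(\mathcal A')=\mathcal P$, and for every $x(0)\in\mathcal P$ the (extended) optimal solutions for the horizons $N$ and $N+l$ are equal. Let $\mathbb P_N^\circ$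 be the union of the polytopes $\mathcal P_N(\mathcal A)$ over all persistent active sets $\mathcal A$ for horizon $N$ that contain no terminal constraint. Let $\mathbb P_N$ be the union of the same polytopes, each taken together with the points of its relative boundary whose active set is $\mathcal A$; that is, $\mathbb P_N$ is the set of all $x(0)\in\mathcal F_N$ whose active set is persistent and contains no terminal constraint. Claim. For every $N$: (i) $\mathbb P_N$ is positively invariant under the open-loop optimally controlled system: if $x(0)\in\mathbb P_N$, then $x^\star(k)\in\mathbb P_N$ for all $k\ge 0$. (ii) $\mathcal F_N$ is convex and contains the convex hull of $\mathbb P_N$. (iii) $\mathbb P_N^\circ\subseteq\mathbb P_N\subseteq\overline{\mathbb P_N^\circ}$. In general $\mathbb P_N$ is not convex: there are data that satisfy all the assumptions, and a horizon $N\ge 1$, for which neither $\mathbb P_N$ nor $\mathbb P_N^\circ$ is convex. -/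

import Mathlib

open scoped Matrix

namespace ConstrainedLQR

/-- Data of a constrained linear quadratic optimal control problem: the matrices, and finitely many
linear inequalities describing the state, input and terminal constraint sets. -/
structure OCP (n m qX qU qT : ℕ) where
  A : Matrix (Fin n) (Fin n) ℝ
  B : Matrix (Fin n) (Fin m) ℝ
  Q : Matrix (Fin n) (Fin n) ℝ
  R : Matrix (Fin m) (Fin m) ℝ
  P : Matrix (Fin n) (Fin n) ℝ
  /-- normals and offsets of the halfspaces that define the state constraint set -/
  nX : Fin qX → Fin n → ℝ
  bX : Fin qX → ℝ
  /-- normals and offsets of the halfspaces that define the input constraint set -/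
  nU : Fin qU → Fin m → ℝ
  bU : Fin qU → ℝ
  /-- normals and offsets of the halfspaces that define the terminal set -/
  nT : Fin qT → Fin n → ℝ
  bT : Fin qT → ℝ

namespace OCP

variable {n m qX qU qT : ℕ} (D : OCP n m qX qU qT)

/-- The state constraint set. -/
def X : Set (Fin n → ℝ) := {ξ | ∀ i, D.nX i ⬝ᵥ ξ ≤ D.bX i}

/-- The input constraint set. -/
def U : Set (Fin m → ℝ) := {μ | ∀ i, D.nU i ⬝ᵥ μ ≤ D.bU i}

/-- The gain of the unconstrained infinite-horizon regulator `u = K x`. -/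
noncomputable def K : Matrix (Fin m) (Fin n) ℝ :=
  -((D.Bᵀ * D.P * D.B + D.R)⁻¹ * D.Bᵀ * D.P * D.A)

/-- States that satisfy the state constraints and at which the feedback `u = K x` satisfies the
input constraints. -/
def XU : Set (Fin n → ℝ) := {ξ | ξ ∈ D.X ∧ D.K *ᵥ ξ ∈ D.U}

/-- The terminal set: the states in `X` from which the unconstrained regulator respects all
constraints for all times. -/
def terminalSet : Set (Fin n → ℝ) :=
  {ξ | ξ ∈ D.X ∧ ∀ k : ℕ, ((D.A + D.B * D.K) ^ k) *ᵥ ξ ∈ D.XU}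

/-- The Kalman controllability matrix `[B, A B, …, A ^ (n - 1) B]`. -/
def controllabilityMatrix : Matrix (Fin n) (Fin n × Fin m) ℝ :=
  Matrix.of fun i p => (D.A ^ (p.1 : ℕ) * D.B) i p.2

/-- The standing assumptions on the problem data. -/
structure Standing : Prop where
  controllable : D.controllabilityMatrix.rank = n
  Q_posSemidef : D.Q.PosSemidef
  R_posDef : D.R.PosDef
  P_posSemidef : D.P.PosSemidef
  /-- the discrete-time algebraic Riccati equation -/
  riccati : D.P =
    D.Aᵀ * (D.P - D.P * D.B * (D.R + D.Bᵀ * D.P * D.B)⁻¹ * D.Bᵀ * D.P) * D.A + D.Q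
  nX_ne_zero : ∀ i, D.nX i ≠ 0
  nU_ne_zero : ∀ i, D.nU i ≠ 0
  nT_ne_zero : ∀ i, D.nT i ≠ 0
  X_compact : IsCompact D.X
  U_compact : IsCompact D.U
  zero_mem_interior_X : (0 : Fin n → ℝ) ∈ interior D.X
  zero_mem_interior_U : (0 : Fin m → ℝ) ∈ interior D.U
  /-- the terminal inequalities describe the terminal set -/
  terminal_eq : {ξ | ∀ i, D.nT i ⬝ᵥ ξ ≤ D.bT i} = D.terminalSet

/-- The states `x(k)`, `k ≥ 0`, that result from the initial state `x₀` if the inputs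
`u(0), …, u(N-1)` are applied, followed by the feedback `u(k) = K x(k)` for `k ≥ N`. -/
noncomputable def state {N : ℕ} (x₀ : Fin n → ℝ) (u : Fin N → Fin m → ℝ) : ℕ → Fin n → ℝ
  | 0 => x₀
  | k + 1 =>
    D.A *ᵥ state x₀ u k + D.B *ᵥ (if h : k < N then u ⟨k, h⟩ else D.K *ᵥ state x₀ u k)

/-- The inputs `u(k)`, `k ≥ 0`, that belong to `state`. -/
noncomputable def input {N : ℕ} (x₀ : Fin n → ℝ) (u : Fin N → Fin m → ℝ) (k : ℕ) : Fin m → ℝ :=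
  if h : k < N then u ⟨k, h⟩ else D.K *ᵥ D.state x₀ u k

/-- The cost function for horizon `N`, as a function of the initial state and the inputs. -/
noncomputable def cost {N : ℕ} (x₀ : Fin n → ℝ) (u : Fin N → Fin m → ℝ) : ℝ :=
  1 / 2 * (D.state x₀ u N ⬝ᵥ (D.P *ᵥ D.state x₀ u N)) +
    1 / 2 * ∑ k : Fin N,
      (D.state x₀ u k ⬝ᵥ (D.Q *ᵥ D.state x₀ u k) + u k ⬝ᵥ (D.R *ᵥ u k))

/-- Index set of the inequality constraints for horizon `N`, ordered stage by stage: the stages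
`0, …, N-1` contribute the `qX` state and the `qU` input constraints, and stage `N` contributes the
`qT` terminal constraints. -/
abbrev Constraint (qX qU qT N : ℕ) : Type := (Fin N × (Fin qX ⊕ Fin qU)) ⊕ Fin qT

/-- The residual (left-hand side minus right-hand side) of an inequality constraint. -/
noncomputable def residual {N : ℕ} (x₀ : Fin n → ℝ) (u : Fin N → Fin m → ℝ) :
    Constraint qX qU qT N → ℝ
  | Sum.inl (k, Sum.inl i) => D.nX i ⬝ᵥ D.state x₀ u k - D.bX i
  | Sum.inl (k, Sum.inr i) => D.nU i ⬝ᵥ u k - D.bU i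
  | Sum.inr i => D.nT i ⬝ᵥ D.state x₀ u N - D.bT i

/-- All constraints of the problem with horizon `N` hold. -/
def Feasible {N : ℕ} (x₀ : Fin n → ℝ) (u : Fin N → Fin m → ℝ) : Prop :=
  ∀ i, D.residual x₀ u i ≤ 0

/-- `u` is an optimal input sequence for the initial state `x₀` and horizon `N`. -/
def IsOptimal {N : ℕ} (x₀ : Fin n → ℝ) (u : Fin N → Fin m → ℝ) : Prop :=
  D.Feasible x₀ u ∧ ∀ v : Fin N → Fin m → ℝ, D.Feasible x₀ v → D.cost x₀ u ≤ D.cost x₀ v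

/-- The initial states for which the problem with horizon `N` has a solution. -/
def feasibleSet (N : ℕ) : Set (Fin n → ℝ) :=
  {x₀ | ∃ u : Fin N → Fin m → ℝ, D.IsOptimal x₀ u}

/-- `a` is the set of the constraints that are active at the optimum for the initial state `x₀`. -/
def HasActiveSet (N : ℕ) (x₀ : Fin n → ℝ) (a : Set (Constraint qX qU qT N)) : Prop :=
  ∃ u : Fin N → Fin m → ℝ, D.IsOptimal x₀ u ∧ a = {i | D.residual x₀ u i = 0}

/-- `a` is an active set for horizon `N`. -/
def IsActiveSet (N : ℕ) (a : Set (Constraint qX qU qT N)) : Prop :=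
  ∃ x₀, D.HasActiveSet N x₀ a

/-- No terminal constraint belongs to `a`. -/
def TerminalInactive {N : ℕ} (a : Set (Constraint qX qU qT N)) : Prop :=
  ∀ i : Fin qT, Sum.inr i ∉ a

/-- The Karush-Kuhn-Tucker conditions for the active set `a` and the initial state `x₀`, with
inputs `u` and multipliers `σ`. -/
def KKT {N : ℕ} (a : Set (Constraint qX qU qT N)) (x₀ : Fin n → ℝ) (u : Fin N → Fin m → ℝ)
    (σ : Constraint qX qU qT N → ℝ) : Prop :=
  HasFDerivAt (fun v : Fin N → Fin m → ℝ => D.cost x₀ v + ∑ i, σ i * D.residual x₀ v i)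
      (0 : (Fin N → Fin m → ℝ) →L[ℝ] ℝ) u ∧
    (∀ i ∈ a, D.residual x₀ u i = 0) ∧ (∀ i ∉ a, D.residual x₀ u i ≤ 0) ∧
    (∀ i ∉ a, σ i = 0) ∧ (∀ i ∈ a, 0 ≤ σ i)

/-- The polytope defined by `a`: the relative interior of the set of the initial states for which
the Karush-Kuhn-Tucker conditions for `a` have a solution. -/
def polytope (N : ℕ) (a : Set (Constraint qX qU qT N)) : Set (Fin n → ℝ) :=
  intrinsicInterior ℝ {x₀ | ∃ u σ, D.KKT a x₀ u σ}

/-- The polytope `S` and the optimal solution on it are persistent from horizon `N` on: for all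
horizons `N + l`, the set `S` is the polytope defined by some active set, and the optimal solutions
for the horizons `N` and `N + l` coincide for all initial states in `S`. -/
def IsPersistent (N : ℕ) (S : Set (Fin n → ℝ)) : Prop :=
  ∀ l : ℕ,
    (∃ a : Set (Constraint qX qU qT (N + l)), D.IsActiveSet (N + l) a ∧
      D.polytope (N + l) a = S) ∧
    ∀ x₀ ∈ S, ∃ (u : Fin N → Fin m → ℝ) (u' : Fin (N + l) → Fin m → ℝ),
      D.IsOptimal x₀ u ∧ D.IsOptimal x₀ u' ∧
      ∀ k : ℕ, D.input x₀ u k = D.input x₀ u' k ∧ D.state x₀ u k = D.state x₀ u' k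

/-- `a` is an active set for horizon `N` without active terminal constraints, and it defines a
polytope that is persistent from horizon `N` on. -/
def IsPersistentActiveSet (N : ℕ) (a : Set (Constraint qX qU qT N)) : Prop :=
  D.IsActiveSet N a ∧ TerminalInactive a ∧ D.IsPersistent N (D.polytope N a)

/-- The union of the relatively open persistent polytopes whose active sets have inactive terminal
constraints. -/
def openPersistentRegion (N : ℕ) : Set (Fin n → ℝ) :=
  {x₀ | ∃ a, D.IsPersistentActiveSet N a ∧ x₀ ∈ D.polytope N a}

/-- The union of the persistent polytopes whose active sets have inactive terminal constraints,
where a polytope includes those points of its relative boundary at which the constraints active at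
the optimum are precisely those of its active set: `x₀` belongs to the region if and only if the
active set of `x₀` is a persistent one with inactive terminal constraints. -/
def persistentRegion (N : ℕ) : Set (Fin n → ℝ) :=
  {x₀ | ∃ a, D.IsPersistentActiveSet N a ∧ D.HasActiveSet N x₀ a}

end OCP

end ConstrainedLQR

/-! The central fact is that an active set without terminal constraints is automatically persistent.
Hence `persistentRegion N` is the set of initial states whose optimal `x(N)` satisfies all terminal
inequalities strictly (`Standing.mem_persistentRegion_iff`).

By the Riccati equation and completion of squares, the cost for horizon `N + 1` is the cost for
horizon `N` plus half the `gainWeight`-norm squared of `u(N) - K x(N)` (`Standing.bil_succ`).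
Appending `u(N) = K x(N)` is therefore free, and it preserves feasibility because the terminal set
is positively invariant. If `x(N)` is terminally strict, no constraint becomes active in the new
stage, since `A + B K` maps strict points to strict points (`Standing.terminalStrict_closedLoop`).
So the KKT conditions carry over in both directions on the same initial states. Invariance follows
by appending one stage and dropping the first one, by the principle of optimality.

Farkas' lemma removes the multipliers from the KKT conditions. What remains is stable under convex
combinations of pairs (initial state, inputs), so each polytope is the relative interior of a convex
set, and prolonging segments shows that the active set is constant on it. This yields both
inclusions between the two regions.

In the counterexample `K = (1, 0)` and `N = 1`. Where the input is unsaturated, the first coordinate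
of `x(1)` is `x 1`, so strictness demands `x 1 < 1`. Where it saturates at `1`, the bound relaxes to
`x 1 < 3/4 + x 0 / 4`, which exceeds `1` once `x 0 > 1`. This creates a reentrant corner at `(1,
1)`. -/

namespace ConstrainedLQR

/-! ### Multipliers and relative interiors -/

/-- **Farkas' lemma** for finitely many linear forms on a real vector space. -/
theorem exists_multipliers {ι V : Type*} [AddCommGroup V] [Module ℝ V] [DecidableEq ι]
    (s : Finset ι) : ∀ (a : ι → V →ₗ[ℝ] ℝ) (f : V →ₗ[ℝ] ℝ),
      (∀ d, (∀ i ∈ s, a i d ≤ 0) → 0 ≤ f d) →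
      ∃ σ : ι → ℝ, (∀ i ∈ s, 0 ≤ σ i) ∧ ∀ d, f d + ∑ i ∈ s, σ i * a i d = 0 := by
  induction s using Finset.induction_on with
  | empty =>
    intro a f h
    refine ⟨0, by simp, fun d => ?_⟩
    have h1 := h d (by simp)
    have h2 := h (-d) (by simp)
    rw [map_neg] at h2
    simp
    linarith
  | insert j s hj ih =>
    intro a f h
    -- If the forms in `s` already force `f` to be nonnegative, form `j` gets the multiplier zero.
    by_cases hs : ∀ d, (∀ i ∈ s, a i d ≤ 0) → 0 ≤ f d
    · obtain ⟨σ, hσ, he⟩ := ih a f hs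
      refine ⟨fun i => if i = j then 0 else σ i, fun i hi => ?_, fun d => ?_⟩
      · dsimp only
        split_ifs with hij
        · rfl
        · exact hσ i ((Finset.mem_insert.1 hi).resolve_left hij)
      · have h1 : ∑ i ∈ s, (if i = j then 0 else σ i) * a i d = ∑ i ∈ s, σ i * a i d :=
          Finset.sum_congr rfl fun i hi => by rw [if_neg (ne_of_mem_of_not_mem hi hj)]
        simp only [Finset.sum_insert hj, if_true, zero_mul, zero_add, h1, he d]
    · push Not at hs
      obtain ⟨d₁, hd₁, hf₁⟩ := hs
      have hj₁ : 0 < a j d₁ := by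
        by_contra hle
        refine absurd (h d₁ fun i hi => ?_) (not_le.2 hf₁)
        rcases Finset.mem_insert.1 hi with rfl | hi
        · exact not_lt.1 hle
        · exact hd₁ i hi
      -- The normalization `a j d₀ = 1` makes `p` below the projection onto the kernel of `a j`
      -- along `d₀`, where constraint `j` is void and the induction hypothesis applies.
      obtain ⟨d₀, hd₀, hf₀, hj₀⟩ : ∃ d₀, (∀ i ∈ s, a i d₀ ≤ 0) ∧ f d₀ < 0 ∧ a j d₀ = 1 := by
        refine ⟨(a j d₁)⁻¹ • d₁, fun i hi => ?_, ?_, ?_⟩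
        · rw [map_smul, smul_eq_mul]
          exact mul_nonpos_of_nonneg_of_nonpos (inv_nonneg.2 hj₁.le) (hd₁ i hi)
        · rw [map_smul, smul_eq_mul]
          exact mul_neg_of_pos_of_neg (inv_pos.2 hj₁) hf₁
        · rw [map_smul, smul_eq_mul, inv_mul_cancel₀ hj₁.ne']
      let p : V →ₗ[ℝ] V := LinearMap.id - (a j).smulRight d₀
      have hp : ∀ d, p d = d - a j d • d₀ := fun d => rfl
      obtain ⟨σ, hσ, he⟩ := ih (fun i => (a i).comp p) (f.comp p) (by
        intro d hd
        refine h (p d) fun i hi => ?_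
        rcases Finset.mem_insert.1 hi with rfl | hi
        · rw [hp, map_sub, map_smul, hj₀]
          simp
        · exact hd i hi)
      -- The multiplier of `j` is dictated by the required identity at `d₀`; `f d₀ < 0` gives its
      -- sign.
      have hc : 0 ≤ -(f d₀ + ∑ i ∈ s, σ i * a i d₀) := by
        have : ∑ i ∈ s, σ i * a i d₀ ≤ 0 := Finset.sum_nonpos fun i hi =>
          mul_nonpos_of_nonneg_of_nonpos (hσ i hi) (hd₀ i hi)
        linarith
      refine ⟨fun i => if i = j then -(f d₀ + ∑ i ∈ s, σ i * a i d₀) else σ i,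
        fun i hi => ?_, fun d => ?_⟩
      · dsimp only
        split_ifs with hij
        · exact hc
        · exact hσ i ((Finset.mem_insert.1 hi).resolve_left hij)
      · have h1 : ∑ i ∈ s, (if i = j then -(f d₀ + ∑ i ∈ s, σ i * a i d₀) else σ i) * a i d =
            ∑ i ∈ s, σ i * a i d :=
          Finset.sum_congr rfl fun i hi => by rw [if_neg (ne_of_mem_of_not_mem hi hj)]
        have h2 := he d
        simp only [LinearMap.comp_apply, hp, map_sub, map_smul, smul_eq_mul, mul_sub,
          Finset.sum_sub_distrib] at h2
        have h3 : ∑ i ∈ s, σ i * (a j d * a i d₀) = a j d * ∑ i ∈ s, σ i * a i d₀ := by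
          rw [Finset.mul_sum]
          exact Finset.sum_congr rfl fun i _ => by ring
        simp only [Finset.sum_insert hj, if_true, h1]
        rw [h3] at h2
        linarith

section IntrinsicInterior

variable {V : Type*} [NormedAddCommGroup V] [NormedSpace ℝ V]

/-- A finite-dimensional convex set lies in the closure of its relative interior. -/
theorem _root_.Convex.subset_closure_intrinsicInterior [FiniteDimensional ℝ V] {s : Set V}
    (hs : Convex ℝ s) : s ⊆ closure (intrinsicInterior ℝ s) := by
  intro x hx
  have : Nonempty s := ⟨⟨x, hx⟩⟩
  let p : affineSpan ℝ s := ⟨x, subset_affineSpan _ _ hx⟩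
  -- The affine span is identified with its direction, a normed space in which the set has nonempty
  -- interior.
  let φ := (AffineIsometryEquiv.constVSub ℝ p).symm
  let t : Set (affineSpan ℝ s).direction := φ ⁻¹' ((↑) ⁻¹' s : Set (affineSpan ℝ s))
  have ht : Convex ℝ t := hs.affine_preimage
    ((affineSpan ℝ s).subtype.comp φ.toAffineEquiv.toAffineMap)
  have hint : φ ⁻¹' interior ((↑) ⁻¹' s : Set (affineSpan ℝ s)) = interior t :=
    φ.toHomeomorph.preimage_interior _
  have hne : (interior t).Nonempty := by
    obtain ⟨_, y, hy, -⟩ := Set.Nonempty.intrinsicInterior hs ⟨x, hx⟩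
    refine ⟨φ.symm y, ?_⟩
    rw [← hint]
    simpa using hy
  have hφ : φ (φ.symm p) = p := φ.apply_symm_apply p
  have h1 : φ.symm p ∈ closure (interior t) := by
    rw [ht.closure_interior_eq_closure_of_nonempty_interior hne]
    refine subset_closure ?_
    change ((φ (φ.symm p) : affineSpan ℝ s) : V) ∈ s
    rw [hφ]
    exact hx
  have hcont : Continuous fun v => ((φ v : affineSpan ℝ s) : V) :=
    continuous_subtype_val.comp φ.continuous
  have h2 := image_closure_subset_closure_image hcont ⟨_, h1, rfl⟩
  dsimp only at h2
  rw [hφ] at h2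
  refine closure_mono ?_ h2
  rintro _ ⟨v, hv, rfl⟩
  rw [← hint] at hv
  exact ⟨φ v, hv, rfl⟩

/-- A segment that ends in the relative interior can be prolonged beyond its end. -/
theorem exists_combo_of_mem_intrinsicInterior {s : Set V} {x y : V}
    (hx : x ∈ intrinsicInterior ℝ s) (hy : y ∈ s) :
    ∃ z ∈ s, ∃ t : ℝ, 0 < t ∧ t < 1 ∧ x = t • y + (1 - t) • z := by
  obtain ⟨x, hx, rfl⟩ := hx
  let y' : affineSpan ℝ s := ⟨y, subset_affineSpan _ _ hy⟩
  -- The line from `y` through `x` inside the affine span; `γ 1 = x`, so parameters slightly above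
  -- `1` still give points of `s`.
  let γ : ℝ → affineSpan ℝ s := fun c =>
    ⟨AffineMap.lineMap y (x : V) c, AffineMap.lineMap_mem c y'.2 x.2⟩
  have hγ : Continuous γ := by
    refine Continuous.subtype_mk ?_ _
    exact AffineMap.lineMap_continuous
  have h1 : γ 1 = x := Subtype.ext (by simp [γ])
  have hev : ∀ᶠ c in nhds (1 : ℝ), γ c ∈ interior ((↑) ⁻¹' s : Set (affineSpan ℝ s)) :=
    hγ.continuousAt.eventually_mem (isOpen_interior.mem_nhds (h1 ▸ hx))
  obtain ⟨ε, hε, hball⟩ := Metric.eventually_nhds_iff.1 hev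
  have hc : γ (1 + ε / 2) ∈ interior ((↑) ⁻¹' s : Set (affineSpan ℝ s)) :=
    hball (by rw [Real.dist_eq, abs_of_pos] <;> linarith)
  have hc' : AffineMap.lineMap y (x : V) (1 + ε / 2) ∈ s := by
    have := interior_subset hc
    exact this
  have hpos : (0 : ℝ) < 1 + ε / 2 := by linarith
  refine ⟨_, hc', 1 - (1 + ε / 2)⁻¹, ?_, ?_, ?_⟩
  · have : (1 + ε / 2)⁻¹ < 1 := inv_lt_one_of_one_lt₀ (by linarith)
    linarith
  · have := inv_pos.2 hpos
    linarith
  · rw [AffineMap.lineMap_apply_module', sub_sub_cancel, smul_add, smul_smul,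
      inv_mul_cancel₀ hpos.ne']
    module

end IntrinsicInterior

/-! ### Linearity of trajectories and the quadratic cost -/

namespace OCP

variable {n m qX qU qT : ℕ} (D : OCP n m qX qU qT) {N : ℕ}

theorem state_zero (x : Fin n → ℝ) (u : Fin N → Fin m → ℝ) : D.state x u 0 = x := rfl

theorem state_succ (x : Fin n → ℝ) (u : Fin N → Fin m → ℝ) (k : ℕ) :
    D.state x u (k + 1) = D.A *ᵥ D.state x u k + D.B *ᵥ D.input x u k := rfl

theorem state_add (x y : Fin n → ℝ) (u v : Fin N → Fin m → ℝ) (k : ℕ) :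
    D.state (x + y) (u + v) k = D.state x u k + D.state y v k := by
  induction k with
  | zero => rfl
  | succ k ih =>
    simp only [state, ih]
    split_ifs
    · simp only [Pi.add_apply, Matrix.mulVec_add]; abel
    · simp only [Matrix.mulVec_add]; abel

theorem state_smul (c : ℝ) (x : Fin n → ℝ) (u : Fin N → Fin m → ℝ) (k : ℕ) :
    D.state (c • x) (c • u) k = c • D.state x u k := by
  induction k with
  | zero => rfl
  | succ k ih =>
    simp only [state, ih]
    split_ifs <;> simp only [Pi.smul_apply, Matrix.mulVec_smul, smul_add]

/-- The linear part of the left-hand side of a constraint. -/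
noncomputable def lhs (x : Fin n → ℝ) (u : Fin N → Fin m → ℝ) : Constraint qX qU qT N → ℝ
  | Sum.inl (k, Sum.inl i) => D.nX i ⬝ᵥ D.state x u k
  | Sum.inl (k, Sum.inr i) => D.nU i ⬝ᵥ u k
  | Sum.inr i => D.nT i ⬝ᵥ D.state x u N

/-- The right-hand side of a constraint. -/
def rhs : Constraint qX qU qT N → ℝ
  | Sum.inl (_, Sum.inl i) => D.bX i
  | Sum.inl (_, Sum.inr i) => D.bU i
  | Sum.inr i => D.bT i

theorem residual_eq (x : Fin n → ℝ) (u : Fin N → Fin m → ℝ) (i : Constraint qX qU qT N) :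
    D.residual x u i = D.lhs x u i - D.rhs i := by
  rcases i with ⟨k, i | i⟩ | i <;> rfl

theorem lhs_add (x y : Fin n → ℝ) (u v : Fin N → Fin m → ℝ) (i : Constraint qX qU qT N) :
    D.lhs (x + y) (u + v) i = D.lhs x u i + D.lhs y v i := by
  rcases i with ⟨k, i | i⟩ | i <;> simp [lhs, state_add, dotProduct_add]

theorem lhs_smul (c : ℝ) (x : Fin n → ℝ) (u : Fin N → Fin m → ℝ) (i : Constraint qX qU qT N) :
    D.lhs (c • x) (c • u) i = c * D.lhs x u i := by
  rcases i with ⟨k, i | i⟩ | i <;> simp [lhs, state_smul, dotProduct_smul]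

/-- The symmetric bilinear form whose quadratic form is twice the cost. -/
noncomputable def bil (x : Fin n → ℝ) (u : Fin N → Fin m → ℝ) (y : Fin n → ℝ)
    (v : Fin N → Fin m → ℝ) : ℝ :=
  D.state x u N ⬝ᵥ (D.P *ᵥ D.state y v N) +
    ∑ k : Fin N, (D.state x u k ⬝ᵥ (D.Q *ᵥ D.state y v k) + u k ⬝ᵥ (D.R *ᵥ v k))

theorem cost_eq (x : Fin n → ℝ) (u : Fin N → Fin m → ℝ) :
    D.cost x u = 1 / 2 * D.bil x u x u := by
  rw [cost, bil]; ring

theorem bil_add_right (x : Fin n → ℝ) (u : Fin N → Fin m → ℝ) (y y' : Fin n → ℝ)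
    (v v' : Fin N → Fin m → ℝ) :
    D.bil x u (y + y') (v + v') = D.bil x u y v + D.bil x u y' v' := by
  simp only [bil, state_add, Pi.add_apply, Matrix.mulVec_add, dotProduct_add,
    Finset.sum_add_distrib]
  ring

theorem bil_smul_right (x : Fin n → ℝ) (u : Fin N → Fin m → ℝ) (c : ℝ) (y : Fin n → ℝ)
    (v : Fin N → Fin m → ℝ) : D.bil x u (c • y) (c • v) = c * D.bil x u y v := by
  simp only [bil, state_smul, Pi.smul_apply, Matrix.mulVec_smul, dotProduct_smul, smul_eq_mul,
    mul_add, Finset.mul_sum]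

theorem dotProduct_mulVec_comm_of_isHermitian {k : ℕ} {M : Matrix (Fin k) (Fin k) ℝ}
    (hM : M.IsHermitian) (x y : Fin k → ℝ) : x ⬝ᵥ (M *ᵥ y) = y ⬝ᵥ (M *ᵥ x) := by
  have h : Mᵀ = M := by rw [← Matrix.conjTranspose_eq_transpose_of_trivial, hM.eq]
  rw [Matrix.dotProduct_mulVec, ← Matrix.mulVec_transpose, h, dotProduct_comm]

variable {D}

theorem Standing.bil_comm (h : D.Standing) (x : Fin n → ℝ) (u : Fin N → Fin m → ℝ)
    (y : Fin n → ℝ) (v : Fin N → Fin m → ℝ) : D.bil x u y v = D.bil y v x u := by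
  simp only [bil, dotProduct_mulVec_comm_of_isHermitian h.P_posSemidef.1 (D.state x u _),
    dotProduct_mulVec_comm_of_isHermitian h.Q_posSemidef.1 (D.state x u _),
    dotProduct_mulVec_comm_of_isHermitian h.R_posDef.1 (u _)]

theorem Standing.bil_add_left (h : D.Standing) (x x' : Fin n → ℝ) (u u' : Fin N → Fin m → ℝ)
    (y : Fin n → ℝ) (v : Fin N → Fin m → ℝ) :
    D.bil (x + x') (u + u') y v = D.bil x u y v + D.bil x' u' y v := by
  rw [h.bil_comm, bil_add_right, h.bil_comm y v, h.bil_comm y v]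

theorem Standing.bil_smul_left (h : D.Standing) (c : ℝ) (x : Fin n → ℝ) (u : Fin N → Fin m → ℝ)
    (y : Fin n → ℝ) (v : Fin N → Fin m → ℝ) :
    D.bil (c • x) (c • u) y v = c * D.bil x u y v := by
  rw [h.bil_comm, bil_smul_right, h.bil_comm y v]

theorem Standing.cost_add (h : D.Standing) (x y : Fin n → ℝ) (u v : Fin N → Fin m → ℝ) :
    D.cost (x + y) (u + v) = D.cost x u + D.bil x u y v + D.cost y v := by
  rw [cost_eq, cost_eq, cost_eq, bil_add_right, h.bil_add_left, h.bil_add_left,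
    h.bil_comm y v x u]
  ring

theorem Standing.cost_add_smul (h : D.Standing) (x : Fin n → ℝ) (u d : Fin N → Fin m → ℝ)
    (t : ℝ) :
    D.cost x (u + t • d) = D.cost x u + t * D.bil x u 0 d + t ^ 2 * D.cost 0 d := by
  have h1 := h.cost_add x (t • (0 : Fin n → ℝ)) u (t • d)
  rw [bil_smul_right, cost_eq _ (t • (0 : Fin n → ℝ)), bil_smul_right, h.bil_smul_left,
    smul_zero, add_zero] at h1
  rw [h1, cost_eq _ 0 d]
  ring

theorem residual_add_smul (x : Fin n → ℝ) (u d : Fin N → Fin m → ℝ) (t : ℝ)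
    (i : Constraint qX qU qT N) :
    D.residual x (u + t • d) i = D.residual x u i + t * D.lhs 0 d i := by
  have h1 := D.lhs_add x (t • (0 : Fin n → ℝ)) u (t • d) i
  rw [lhs_smul, smul_zero, add_zero] at h1
  rw [residual_eq, residual_eq, h1]
  ring

theorem residual_combo (x y : Fin n → ℝ) (u v : Fin N → Fin m → ℝ) {s t : ℝ} (hst : s + t = 1)
    (i : Constraint qX qU qT N) :
    D.residual (s • x + t • y) (s • u + t • v) i =
      s * D.residual x u i + t * D.residual y v i := by
  simp only [residual_eq, lhs_add, lhs_smul]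
  linear_combination D.rhs i * hst

theorem Standing.cost_nonneg (h : D.Standing) (x : Fin n → ℝ) (u : Fin N → Fin m → ℝ) :
    0 ≤ D.cost x u := by
  have hP := h.P_posSemidef.dotProduct_mulVec_nonneg
  have hQ := h.Q_posSemidef.dotProduct_mulVec_nonneg
  have hR := h.R_posDef.posSemidef.dotProduct_mulVec_nonneg
  simp only [star_trivial] at hP hQ hR
  have := Finset.sum_nonneg fun (k : Fin N) (_ : k ∈ Finset.univ) =>
    add_nonneg (hQ (D.state x u k)) (hR (u k))
  rw [cost]
  linarith [hP (D.state x u N)]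

/-- Positive definiteness of `R` alone controls the inputs. Applied at initial state `0` to a
difference of inputs, this is strict convexity of the cost. -/
theorem Standing.eq_zero_of_cost_le (h : D.Standing) (x : Fin n → ℝ) (u : Fin N → Fin m → ℝ)
    (hu : D.cost x u ≤ 0) : u = 0 := by
  have hP := h.P_posSemidef.dotProduct_mulVec_nonneg
  have hQ := h.Q_posSemidef.dotProduct_mulVec_nonneg
  have hR := h.R_posDef.posSemidef.dotProduct_mulVec_nonneg
  have hR' := fun {x} => h.R_posDef.dotProduct_mulVec_pos (x := x)
  simp only [star_trivial] at hP hQ hR hR'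
  have hnn : ∀ k : Fin N, 0 ≤ D.state x u k ⬝ᵥ (D.Q *ᵥ D.state x u k) + u k ⬝ᵥ (D.R *ᵥ u k) :=
    fun k => add_nonneg (hQ (D.state x u k)) (hR (u k))
  have hsum := Finset.sum_nonneg fun (k : Fin N) (_ : k ∈ Finset.univ) => hnn k
  rw [cost] at hu
  have h0 := (Finset.sum_eq_zero_iff_of_nonneg fun k _ => hnn k).1
    (le_antisymm (by linarith [hP (D.state x u N)]) hsum)
  funext k
  by_contra hk
  have h1 := hR' hk
  linarith [h0 k (Finset.mem_univ k), hQ (D.state x u k)]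

/-! ### Optimality -/

theorem Standing.isOptimal_unique (h : D.Standing) {x : Fin n → ℝ} {u v : Fin N → Fin m → ℝ}
    (hu : D.IsOptimal x u) (hv : D.IsOptimal x v) : u = v := by
  -- Comparing the cost at the midpoint with that at both optima makes the quadratic term in `v - u`
  -- nonpositive.
  have hmid : D.Feasible x (u + (1 / 2 : ℝ) • (v - u)) := fun i => by
    have h1 := D.residual_add_smul x u (v - u) 1 i
    rw [one_smul, add_sub_cancel] at h1
    rw [residual_add_smul]
    linarith [hu.1 i, hv.1 i]
  have h1 := hu.2 _ hmid
  rw [h.cost_add_smul] at h1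
  have h2 := h.cost_add_smul x u (v - u) 1
  rw [one_smul, add_sub_cancel] at h2
  have h3 := hv.2 u hu.1
  have h4 := h.eq_zero_of_cost_le 0 (v - u) (by nlinarith [hu.2 v hv.1])
  exact (sub_eq_zero.1 h4).symm

theorem differentiable_state (x : Fin n → ℝ) (k : ℕ) :
    ∀ i, Differentiable ℝ fun v : Fin N → Fin m → ℝ => D.state x v k i := by
  induction k with
  | zero => intro i; simp only [state]; fun_prop
  | succ k ih =>
    intro i
    simp only [state]
    split_ifs
    · simp only [Pi.add_apply, Matrix.mulVec, dotProduct]; fun_prop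
    · simp only [Pi.add_apply, Matrix.mulVec, dotProduct]; fun_prop

theorem differentiable_cost (x : Fin n → ℝ) :
    Differentiable ℝ fun v : Fin N → Fin m → ℝ => D.cost x v := by
  have := D.differentiable_state (N := N) x
  simp only [cost, Matrix.mulVec, dotProduct]
  fun_prop

theorem differentiable_residual (x : Fin n → ℝ) (i : Constraint qX qU qT N) :
    Differentiable ℝ fun v : Fin N → Fin m → ℝ => D.residual x v i := by
  have := D.differentiable_state (N := N) x
  rcases i with ⟨k, i | i⟩ | i <;>
  · simp only [residual, dotProduct]
    fun_prop

theorem Standing.exists_isOptimal (h : D.Standing) {x : Fin n → ℝ} {u : Fin N → Fin m → ℝ}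
    (hu : D.Feasible x u) : ∃ v : Fin N → Fin m → ℝ, D.IsOptimal x v := by
  have hsub : {v : Fin N → Fin m → ℝ | D.Feasible x v} ⊆ Set.univ.pi fun _ => D.U :=
    fun v hv k _ i => by
      have := hv (Sum.inl (k, Sum.inr i))
      simpa [residual] using this
  have hclosed : IsClosed {v : Fin N → Fin m → ℝ | D.Feasible x v} := by
    simp only [Feasible, Set.ofPred_forall]
    exact isClosed_iInter fun i =>
      isClosed_le (differentiable_residual x i).continuous continuous_const
  have hcomp := (isCompact_univ_pi fun _ : Fin N => h.U_compact).of_isClosed_subset hclosed hsub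
  obtain ⟨v, hv, hmin⟩ := hcomp.exists_isMinOn ⟨u, hu⟩
    (differentiable_cost x).continuous.continuousOn
  exact ⟨v, hv, fun w hw => hmin hw⟩

theorem Standing.mem_feasibleSet_iff (h : D.Standing) {x : Fin n → ℝ} :
    x ∈ D.feasibleSet N ↔ ∃ u : Fin N → Fin m → ℝ, D.Feasible x u :=
  ⟨fun ⟨u, hu⟩ => ⟨u, hu.1⟩, fun ⟨_, hu⟩ => h.exists_isOptimal hu⟩

theorem Standing.convex_feasibleSet (h : D.Standing) : Convex ℝ (D.feasibleSet N) := by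
  intro x hx y hy s t hs ht hst
  obtain ⟨u, hu⟩ := h.mem_feasibleSet_iff.1 hx
  obtain ⟨v, hv⟩ := h.mem_feasibleSet_iff.1 hy
  refine h.mem_feasibleSet_iff.2 ⟨s • u + t • v, fun i => ?_⟩
  rw [residual_combo _ _ _ _ hst]
  nlinarith [mul_nonneg hs (neg_nonneg.2 (hu i)), mul_nonneg ht (neg_nonneg.2 (hv i))]

/-- A feasible direction, along which the inactive constraints are disregarded, does not decrease
the cost to first order at an optimum. -/
theorem Standing.bil_nonneg_of_isOptimal (h : D.Standing) {x : Fin n → ℝ}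
    {u : Fin N → Fin m → ℝ} (hu : D.IsOptimal x u) (d : Fin N → Fin m → ℝ)
    (hd : ∀ i, D.residual x u i = 0 → D.lhs 0 d i ≤ 0) : 0 ≤ D.bil x u 0 d := by
  -- Short steps along `d` stay feasible: active constraints by `hd`, inactive ones by continuity.
  have hev : ∀ᶠ t in nhdsWithin (0 : ℝ) (Set.Ioi 0), D.Feasible x (u + t • d) := by
    simp only [Feasible, Filter.eventually_all]
    intro i
    rcases (hu.1 i).eq_or_lt with hi | hi
    · filter_upwards [self_mem_nhdsWithin] with t ht
      rw [residual_add_smul, hi, zero_add]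
      exact mul_nonpos_of_nonneg_of_nonpos (le_of_lt ht) (hd i hi)
    · have hc : Continuous fun t : ℝ => D.residual x u i + t * D.lhs 0 d i := by fun_prop
      have : ∀ᶠ t in nhds (0 : ℝ), D.residual x u i + t * D.lhs 0 d i < 0 :=
        hc.continuousAt.eventually_lt continuousAt_const (by simpa using hi)
      filter_upwards [nhdsWithin_le_nhds this] with t ht
      rw [residual_add_smul]
      exact ht.le
  have hev' : ∀ᶠ t in nhdsWithin (0 : ℝ) (Set.Ioi 0), 0 ≤ D.bil x u 0 d + t * D.cost 0 d := by
    filter_upwards [hev, self_mem_nhdsWithin] with t ht htpos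
    have h1 := hu.2 _ ht
    rw [h.cost_add_smul] at h1
    exact nonneg_of_mul_nonneg_right (by nlinarith) (show (0 : ℝ) < t from htpos)
  have hc : Continuous fun t : ℝ => D.bil x u 0 d + t * D.cost 0 d := by fun_prop
  have hlim := (hc.tendsto 0).mono_left (nhdsWithin_le_nhds (s := Set.Ioi (0 : ℝ)))
  simp only [zero_mul, add_zero] at hlim
  exact ge_of_tendsto hlim hev'

/-! ### The Karush-Kuhn-Tucker conditions -/

/-- The Karush-Kuhn-Tucker conditions without multipliers: the constraints in `a` are active, and no
direction in which they remain valid decreases the cost to first order. -/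
def PrimalKKT (D : OCP n m qX qU qT) (a : Set (Constraint qX qU qT N)) (x : Fin n → ℝ)
    (u : Fin N → Fin m → ℝ) : Prop :=
  D.Feasible x u ∧ (∀ i ∈ a, D.residual x u i = 0) ∧
    ∀ d : Fin N → Fin m → ℝ, (∀ i ∈ a, D.lhs 0 d i ≤ 0) → 0 ≤ D.bil x u 0 d

/-- Along each line the Lagrangian is a quadratic polynomial, so its directional derivatives can be
read off; being differentiable, it is stationary exactly when they all vanish. -/
theorem Standing.hasFDerivAt_lagrangian_iff (h : D.Standing) (x : Fin n → ℝ)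
    (u : Fin N → Fin m → ℝ) (σ : Constraint qX qU qT N → ℝ) :
    HasFDerivAt (fun v : Fin N → Fin m → ℝ => D.cost x v + ∑ i, σ i * D.residual x v i)
        (0 : (Fin N → Fin m → ℝ) →L[ℝ] ℝ) u ↔
      ∀ d, D.bil x u 0 d + ∑ i, σ i * D.lhs 0 d i = 0 := by
  set L := fun v : Fin N → Fin m → ℝ => D.cost x v + ∑ i, σ i * D.residual x v i with hL
  have hdiff : Differentiable ℝ L := by
    have h1 := D.differentiable_cost (N := N) x
    have h2 := D.differentiable_residual (N := N) x
    fun_prop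
  have hline : ∀ d, HasDerivAt (fun t : ℝ => L (u + t • d))
      (D.bil x u 0 d + ∑ i, σ i * D.lhs 0 d i) 0 := by
    intro d
    have he : (fun t : ℝ => L (u + t • d)) = fun t => L u +
        t * (D.bil x u 0 d + ∑ i, σ i * D.lhs 0 d i) + t ^ 2 * D.cost 0 d := by
      funext t
      simp only [hL, h.cost_add_smul, residual_add_smul, mul_add, Finset.sum_add_distrib,
        Finset.mul_sum]
      have : ∑ i, σ i * (t * D.lhs 0 d i) = ∑ i, t * (σ i * D.lhs 0 d i) :=
        Finset.sum_congr rfl fun i _ => by ring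
      rw [this]
      ring
    rw [he]
    have h1 := (((hasDerivAt_id (0 : ℝ)).mul_const
      (D.bil x u 0 d + ∑ i, σ i * D.lhs 0 d i)).const_add (L u)).add
      (((hasDerivAt_id (0 : ℝ)).pow 2).mul_const (D.cost 0 d))
    refine HasDerivAt.congr_deriv (f := fun t => L u +
        t * (D.bil x u 0 d + ∑ i, σ i * D.lhs 0 d i) + t ^ 2 * D.cost 0 d) h1 ?_
    simp only [id_eq, one_mul, Nat.cast_ofNat, mul_one, zero_mul, mul_zero, add_zero, pow_one,
      Nat.add_one_sub_one]
  have hchain : ∀ d, HasDerivAt (fun t : ℝ => L (u + t • d)) (fderiv ℝ L u d) 0 := fun d =>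
    (hdiff u).hasFDerivAt.hasLineDerivAt d
  constructor
  · intro hF d
    rw [(hline d).unique (hchain d), hF.fderiv]
    rfl
  · intro hz
    have : fderiv ℝ L u = 0 := by
      ext1 d
      rw [← (hline d).unique (hchain d), hz d]
      rfl
    rw [← this]
    exact (hdiff u).hasFDerivAt

/-- Farkas' lemma in the space of input directions, applied to the constraints in `a` and the
first-order change of the cost. -/
theorem Standing.exists_KKT_iff (h : D.Standing) (a : Set (Constraint qX qU qT N))
    (x : Fin n → ℝ) (u : Fin N → Fin m → ℝ) :
    (∃ σ, D.KKT a x u σ) ↔ D.PrimalKKT a x u := by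
  classical
  simp only [KKT, h.hasFDerivAt_lagrangian_iff]
  constructor
  · rintro ⟨σ, hst, ha, hna, hσ0, hσ⟩
    refine ⟨fun i => ?_, ha, fun d hd => ?_⟩
    · by_cases hi : i ∈ a
      · exact (ha i hi).le
      · exact hna i hi
    · have : ∑ i, σ i * D.lhs 0 d i ≤ 0 := by
        refine Finset.sum_nonpos fun i _ => ?_
        by_cases hi : i ∈ a
        · exact mul_nonpos_of_nonneg_of_nonpos (hσ i hi) (hd i hi)
        · rw [hσ0 i hi, zero_mul]
      linarith [hst d]
  · rintro ⟨hf, ha, hd⟩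
    obtain ⟨σ, hσ, he⟩ := exists_multipliers (Finset.univ.filter (· ∈ a))
      (fun i => (⟨⟨fun d => D.lhs 0 d i, fun d d' => by
          have := D.lhs_add 0 0 d d' i
          rwa [add_zero] at this⟩, fun c d => by
          have := D.lhs_smul c 0 d i
          rwa [smul_zero] at this⟩ : (Fin N → Fin m → ℝ) →ₗ[ℝ] ℝ))
      (⟨⟨fun d => D.bil x u 0 d, fun d d' => by
          have := D.bil_add_right x u 0 0 d d'
          rwa [add_zero] at this⟩, fun c d => by
          have := D.bil_smul_right x u c 0 d
          rwa [smul_zero] at this⟩ : (Fin N → Fin m → ℝ) →ₗ[ℝ] ℝ)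
      (fun d hd' => hd d fun i hi => hd' i (by simpa using hi))
    refine ⟨fun i => if i ∈ a then σ i else 0, fun d => ?_, ha, fun i _ => hf i,
      fun i hi => if_neg hi, fun i hi => ?_⟩
    · have : D.bil x u 0 d + ∑ i ∈ Finset.univ.filter (· ∈ a), σ i * D.lhs 0 d i = 0 := he d
      rw [Finset.sum_filter] at this
      simpa only [ite_mul, zero_mul] using this
    · simp only [hi, if_true]
      exact hσ i (by simpa using hi)

theorem Standing.setOf_KKT_eq (h : D.Standing) (a : Set (Constraint qX qU qT N)) :
    {x₀ | ∃ u σ, D.KKT a x₀ u σ} = {x₀ | ∃ u, D.PrimalKKT a x₀ u} := by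
  ext x
  exact exists_congr fun u => h.exists_KKT_iff a x u

theorem Standing.polytope_eq (h : D.Standing) (a : Set (Constraint qX qU qT N)) :
    D.polytope N a = intrinsicInterior ℝ {x₀ | ∃ u, D.PrimalKKT a x₀ u} := by
  rw [polytope, h.setOf_KKT_eq]

theorem Standing.isOptimal_of_primalKKT (h : D.Standing) {a : Set (Constraint qX qU qT N)}
    {x : Fin n → ℝ} {u : Fin N → Fin m → ℝ} (hu : D.PrimalKKT a x u) : D.IsOptimal x u := by
  refine ⟨hu.1, fun v hv => ?_⟩
  have h1 := h.cost_add_smul x u (v - u) 1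
  rw [one_smul, add_sub_cancel] at h1
  have h2 := hu.2.2 (v - u) fun i hi => by
    have h3 := D.residual_add_smul x u (v - u) 1 i
    rw [one_smul, add_sub_cancel] at h3
    linarith [hv i, hu.2.1 i hi]
  linarith [h.cost_nonneg 0 (v - u)]

theorem Standing.primalKKT_of_isOptimal (h : D.Standing) {x : Fin n → ℝ}
    {u : Fin N → Fin m → ℝ} (hu : D.IsOptimal x u) :
    D.PrimalKKT {i | D.residual x u i = 0} x u :=
  ⟨hu.1, fun _ hi => hi, fun d hd => h.bil_nonneg_of_isOptimal hu d hd⟩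

/-- All three conditions are affine inequalities or equalities in the pair `(x, u)`, which is the
gain from eliminating the multipliers. -/
theorem Standing.primalKKT_combo (h : D.Standing) {a : Set (Constraint qX qU qT N)}
    {x y : Fin n → ℝ} {u v : Fin N → Fin m → ℝ} (hu : D.PrimalKKT a x u)
    (hv : D.PrimalKKT a y v) {s t : ℝ} (hs : 0 ≤ s) (ht : 0 ≤ t) (hst : s + t = 1) :
    D.PrimalKKT a (s • x + t • y) (s • u + t • v) := by
  refine ⟨fun i => ?_, fun i hi => ?_, fun d hd => ?_⟩
  · rw [residual_combo _ _ _ _ hst]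
    nlinarith [mul_nonneg hs (neg_nonneg.2 (hu.1 i)), mul_nonneg ht (neg_nonneg.2 (hv.1 i))]
  · rw [residual_combo _ _ _ _ hst, hu.2.1 i hi, hv.2.1 i hi, mul_zero, mul_zero, add_zero]
  · rw [h.bil_add_left, h.bil_smul_left, h.bil_smul_left]
    exact add_nonneg (mul_nonneg hs (hu.2.2 d hd)) (mul_nonneg ht (hv.2.2 d hd))

theorem Standing.convex_setOf_primalKKT (h : D.Standing) (a : Set (Constraint qX qU qT N)) :
    Convex ℝ {x₀ | ∃ u, D.PrimalKKT a x₀ u} := by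
  rintro x ⟨u, hu⟩ y ⟨v, hv⟩ s t hs ht hst
  exact ⟨_, h.primalKKT_combo hu hv hs ht hst⟩

theorem Standing.polytope_subset (h : D.Standing) (a : Set (Constraint qX qU qT N)) :
    D.polytope N a ⊆ {x₀ | ∃ u, D.PrimalKKT a x₀ u} := by
  rw [h.polytope_eq]
  exact intrinsicInterior_subset

/-- On the polytope of an active set, the active set is constant. -/
theorem Standing.hasActiveSet_of_mem_polytope (h : D.Standing) {a : Set (Constraint qX qU qT N)}
    (ha : D.IsActiveSet N a) {x : Fin n → ℝ} (hx : x ∈ D.polytope N a) :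
    D.HasActiveSet N x a := by
  obtain ⟨y, u, hu, rfl⟩ := ha
  have hu' := h.primalKKT_of_isOptimal hu
  rw [h.polytope_eq] at hx
  -- `x` gets a positive share of `y`, where exactly the constraints in `a` are active; any other
  -- constraint is strict at `y`, hence at `x`.
  obtain ⟨z, ⟨v, hv⟩, t, ht, ht1, rfl⟩ := exists_combo_of_mem_intrinsicInterior hx ⟨u, hu'⟩
  have hc := h.primalKKT_combo hu' hv ht.le (sub_nonneg.2 ht1.le) (add_sub_cancel t 1)
  refine ⟨_, h.isOptimal_of_primalKKT hc, ?_⟩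
  ext i
  refine ⟨fun hi => hc.2.1 i hi, fun hi => ?_⟩
  have hi' : D.residual (t • y + (1 - t) • z) (t • u + (1 - t) • v) i = 0 := hi
  rw [residual_combo _ _ _ _ (add_sub_cancel t 1)] at hi'
  by_contra hne
  have h1 := lt_of_le_of_ne (hu.1 i) hne
  nlinarith [mul_pos ht (neg_pos.2 h1),
    mul_nonneg (sub_nonneg.2 ht1.le) (neg_nonneg.2 (hv.1 i))]

theorem Standing.mem_closure_polytope (h : D.Standing) {a : Set (Constraint qX qU qT N)}
    {x : Fin n → ℝ} (hx : D.HasActiveSet N x a) : x ∈ closure (D.polytope N a) := by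
  obtain ⟨u, hu, rfl⟩ := hx
  rw [h.polytope_eq]
  exact (h.convex_setOf_primalKKT _).subset_closure_intrinsicInterior
    ⟨u, h.primalKKT_of_isOptimal hu⟩

variable {n m qX qU qT : ℕ} {D : OCP n m qX qU qT} {N : ℕ}

/-! ### The Riccati equation -/

variable (D) in
/-- The weight of the deviation from the unconstrained regulator. -/
noncomputable def gainWeight : Matrix (Fin m) (Fin m) ℝ := D.R + D.Bᵀ * D.P * D.B

theorem Standing.gainWeight_posDef (h : D.Standing) : D.gainWeight.PosDef := by
  have := h.P_posSemidef.conjTranspose_mul_mul_same D.B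
  rw [Matrix.conjTranspose_eq_transpose_of_trivial] at this
  exact h.R_posDef.add_posSemidef this

theorem Standing.transpose_P (h : D.Standing) : D.Pᵀ = D.P := by
  rw [← Matrix.conjTranspose_eq_transpose_of_trivial, h.P_posSemidef.1.eq]

theorem Standing.transpose_gainWeight (h : D.Standing) : D.gainWeightᵀ = D.gainWeight := by
  rw [← Matrix.conjTranspose_eq_transpose_of_trivial, h.gainWeight_posDef.1.eq]

theorem Standing.gainWeight_mul_K (h : D.Standing) :
    D.gainWeight * D.K = -(D.Bᵀ * D.P * D.A) := by
  have hu : IsUnit D.gainWeight.det := (Matrix.isUnit_iff_isUnit_det _).1 h.gainWeight_posDef.isUnit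
  have hK : D.K = -(D.gainWeight⁻¹ * (D.Bᵀ * D.P * D.A)) := by
    rw [K, gainWeight, add_comm D.R]
    simp only [Matrix.mul_assoc]
  rw [hK, Matrix.mul_neg, Matrix.mul_nonsing_inv_cancel_left _ _ hu]

theorem Standing.transpose_K_mul_gainWeight (h : D.Standing) :
    D.Kᵀ * D.gainWeight = -(D.Aᵀ * D.P * D.B) := by
  have := congrArg Matrix.transpose h.gainWeight_mul_K
  simpa only [Matrix.transpose_mul, Matrix.transpose_neg, Matrix.transpose_transpose,
    h.transpose_gainWeight, h.transpose_P, ← Matrix.mul_assoc] using this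

theorem Standing.riccati_closed (h : D.Standing) :
    D.Aᵀ * D.P * D.A + D.Q = D.P + D.Kᵀ * D.gainWeight * D.K := by
  have hu : IsUnit D.gainWeight.det := (Matrix.isUnit_iff_isUnit_det _).1 h.gainWeight_posDef.isUnit
  have hK : D.K = -(D.gainWeight⁻¹ * (D.Bᵀ * D.P * D.A)) := by
    rw [K, gainWeight, add_comm D.R]
    simp only [Matrix.mul_assoc]
  have h1 : D.Kᵀ * D.gainWeight * D.K =
      D.Aᵀ * (D.P * D.B * D.gainWeight⁻¹ * D.Bᵀ * D.P) * D.A := by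
    rw [h.transpose_K_mul_gainWeight, hK]
    simp only [Matrix.neg_mul, Matrix.mul_neg, neg_neg, Matrix.mul_assoc]
  have h2 : D.P = D.Aᵀ * (D.P - D.P * D.B * D.gainWeight⁻¹ * D.Bᵀ * D.P) * D.A + D.Q :=
    h.riccati
  rw [h1]
  nth_rewrite 2 [h2]
  rw [Matrix.mul_sub, Matrix.sub_mul]
  abel

theorem mulVec_dotProduct {k l : ℕ} (M : Matrix (Fin k) (Fin l) ℝ) (x : Fin l → ℝ)
    (y : Fin k → ℝ) : (M *ᵥ x) ⬝ᵥ y = x ⬝ᵥ (Mᵀ *ᵥ y) := by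
  rw [Matrix.dotProduct_mulVec, Matrix.vecMul_transpose]

/-- One step of dynamic programming, by completion of squares. -/
theorem Standing.stage_identity (h : D.Standing) (ξ η : Fin n → ℝ) (μ ν : Fin m → ℝ) :
    (D.A *ᵥ ξ + D.B *ᵥ μ) ⬝ᵥ (D.P *ᵥ (D.A *ᵥ η + D.B *ᵥ ν)) +
        (ξ ⬝ᵥ (D.Q *ᵥ η) + μ ⬝ᵥ (D.R *ᵥ ν)) =
      ξ ⬝ᵥ (D.P *ᵥ η) + (μ - D.K *ᵥ ξ) ⬝ᵥ (D.gainWeight *ᵥ (ν - D.K *ᵥ η)) := by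
  have h1 : ξ ⬝ᵥ ((D.Aᵀ * D.P * D.A + D.Q) *ᵥ η) =
      ξ ⬝ᵥ ((D.P + D.Kᵀ * D.gainWeight * D.K) *ᵥ η) := by rw [h.riccati_closed]
  have h2 : μ ⬝ᵥ ((D.gainWeight * D.K) *ᵥ η) = μ ⬝ᵥ ((-(D.Bᵀ * D.P * D.A)) *ᵥ η) := by
    rw [h.gainWeight_mul_K]
  have h3 : ξ ⬝ᵥ ((D.Kᵀ * D.gainWeight) *ᵥ ν) = ξ ⬝ᵥ ((-(D.Aᵀ * D.P * D.B)) *ᵥ ν) := by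
    rw [h.transpose_K_mul_gainWeight]
  have h4 : μ ⬝ᵥ (D.gainWeight *ᵥ ν) = μ ⬝ᵥ ((D.R + D.Bᵀ * D.P * D.B) *ᵥ ν) := rfl
  simp only [Matrix.add_mulVec, Matrix.neg_mulVec, dotProduct_add, dotProduct_neg,
    ← Matrix.mulVec_mulVec] at h1 h2 h3 h4
  simp only [Matrix.mulVec_add, Matrix.mulVec_sub, dotProduct_add, dotProduct_sub, add_dotProduct,
    sub_dotProduct, mulVec_dotProduct]
  linarith

/-! ### The terminal set -/

variable (D) in
/-- The closed-loop matrix. -/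
noncomputable def closedLoop : Matrix (Fin n) (Fin n) ℝ := D.A + D.B * D.K

theorem closedLoop_mulVec (ξ : Fin n → ℝ) :
    D.closedLoop *ᵥ ξ = D.A *ᵥ ξ + D.B *ᵥ (D.K *ᵥ ξ) := by
  rw [closedLoop, Matrix.add_mulVec, Matrix.mulVec_mulVec]

theorem mem_XU_of_mem_terminalSet {ξ : Fin n → ℝ} (hξ : ξ ∈ D.terminalSet) : ξ ∈ D.XU := by
  simpa using hξ.2 0

theorem closedLoop_pow_mem {ξ : Fin n → ℝ} (hξ : ξ ∈ D.terminalSet) (k : ℕ) :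
    (D.closedLoop ^ k) *ᵥ ξ ∈ D.XU := hξ.2 k

theorem closedLoop_mem_terminalSet {ξ : Fin n → ℝ} (hξ : ξ ∈ D.terminalSet) :
    D.closedLoop *ᵥ ξ ∈ D.terminalSet := by
  have hk : ∀ k, D.closedLoop ^ k *ᵥ (D.closedLoop *ᵥ ξ) ∈ D.XU := fun k => by
    rw [Matrix.mulVec_mulVec, ← pow_succ]
    exact closedLoop_pow_mem hξ _
  refine ⟨?_, hk⟩
  have := (hk 0).1
  rwa [pow_zero, Matrix.one_mulVec] at this

theorem mem_terminalSet_iff {ξ : Fin n → ℝ} :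
    ξ ∈ D.terminalSet ↔ ξ ∈ D.XU ∧ D.closedLoop *ᵥ ξ ∈ D.terminalSet := by
  refine ⟨fun hξ => ⟨mem_XU_of_mem_terminalSet hξ, closedLoop_mem_terminalSet hξ⟩,
    fun hξ => ⟨hξ.1.1, fun k => ?_⟩⟩
  cases k with
  | zero => simpa using hξ.1
  | succ k =>
    have := closedLoop_pow_mem hξ.2 k
    rwa [Matrix.mulVec_mulVec, ← pow_succ] at this

theorem Standing.mem_terminalSet (h : D.Standing) {ξ : Fin n → ℝ} :
    ξ ∈ D.terminalSet ↔ ∀ i, D.nT i ⬝ᵥ ξ ≤ D.bT i := by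
  rw [← h.terminal_eq]; rfl

variable (D) in
/-- All terminal constraints hold strictly at `ξ`. -/
def TerminalStrict (ξ : Fin n → ℝ) : Prop := ∀ i, D.nT i ⬝ᵥ ξ < D.bT i

theorem Standing.mem_terminalSet_of_strict (h : D.Standing) {ξ : Fin n → ℝ}
    (hξ : D.TerminalStrict ξ) : ξ ∈ D.terminalSet :=
  h.mem_terminalSet.2 fun i => (hξ i).le

theorem Standing.exists_add_smul_mem (h : D.Standing) {ξ : Fin n → ℝ}
    (hξ : D.TerminalStrict ξ) (v : Fin n → ℝ) : ∃ ε > 0, ξ + (ε : ℝ) • v ∈ D.terminalSet := by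
  have hev : ∀ᶠ t in nhdsWithin (0 : ℝ) (Set.Ioi 0), ξ + t • v ∈ D.terminalSet := by
    simp only [h.mem_terminalSet, Filter.eventually_all]
    intro i
    have hc : Continuous fun t : ℝ => D.nT i ⬝ᵥ ξ + t * (D.nT i ⬝ᵥ v) := by fun_prop
    have : ∀ᶠ t in nhds (0 : ℝ), D.nT i ⬝ᵥ ξ + t * (D.nT i ⬝ᵥ v) < D.bT i :=
      hc.continuousAt.eventually_lt continuousAt_const (by simpa using hξ i)
    filter_upwards [nhdsWithin_le_nhds this] with t ht
    rw [dotProduct_add, dotProduct_smul, smul_eq_mul]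
    exact ht.le
  obtain ⟨ε, h1, h2⟩ := (hev.and self_mem_nhdsWithin).exists
  exact ⟨ε, h2, h1⟩

theorem exists_smul_mem_of_zero_mem_interior {k : ℕ} {s : Set (Fin k → ℝ)}
    (hs : (0 : Fin k → ℝ) ∈ interior s) (v : Fin k → ℝ) : ∃ ε > 0, (ε : ℝ) • v ∈ s := by
  have hc : Continuous fun t : ℝ => t • v := by fun_prop
  have : ∀ᶠ t in nhds (0 : ℝ), t • v ∈ interior s :=
    hc.continuousAt.eventually_mem (isOpen_interior.mem_nhds (by simpa using hs))
  have hev : ∀ᶠ t in nhdsWithin (0 : ℝ) (Set.Ioi 0), t • v ∈ interior s := nhdsWithin_le_nhds this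
  obtain ⟨ε, h1, h2⟩ := (hev.and self_mem_nhdsWithin).exists
  exact ⟨ε, h2, interior_subset h1⟩

theorem Standing.zero_mem_interior_XU (h : D.Standing) : (0 : Fin n → ℝ) ∈ interior D.XU := by
  have hc : Continuous fun ξ : Fin n → ℝ => D.K *ᵥ ξ := by fun_prop
  refine mem_interior.2 ⟨interior D.X ∩ (fun ξ => D.K *ᵥ ξ) ⁻¹' interior D.U,
    fun ξ hξ => ⟨interior_subset hξ.1, interior_subset hξ.2⟩,
    isOpen_interior.inter (isOpen_interior.preimage hc), h.zero_mem_interior_X, ?_⟩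
  simpa using h.zero_mem_interior_U

/-- If some point satisfies the terminal constraints strictly, then the closed loop is bounded, so
that the terminal set is absorbing. -/
theorem Standing.exists_smul_mem_terminalSet (h : D.Standing) {ξ : Fin n → ℝ}
    (hξ : D.TerminalStrict ξ) (v : Fin n → ℝ) : ∃ δ > 0, (δ : ℝ) • v ∈ D.terminalSet := by
  obtain ⟨ε, hε, hv⟩ := h.exists_add_smul_mem hξ v
  obtain ⟨C, hC⟩ := h.X_compact.isBounded.exists_norm_le
  obtain ⟨r, hr, hball⟩ := Metric.mem_nhds_iff.1 (mem_interior_iff_mem_nhds.1 h.zero_mem_interior_XU)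
  have hC0 : 0 ≤ C := (norm_nonneg _).trans (hC _ (h.mem_terminalSet_of_strict hξ).1)
  -- The orbit of `ε • v` is the difference of two orbits that stay in the bounded set `X`. No
  -- stability of the closed loop is needed.
  have hb : ∀ k, ‖D.closedLoop ^ k *ᵥ (ε • v)‖ ≤ 2 * C := fun k => by
    have h1 := hC _ (closedLoop_pow_mem hv k).1
    have h2 := hC _ (closedLoop_pow_mem (h.mem_terminalSet_of_strict hξ) k).1
    have h3 : D.closedLoop ^ k *ᵥ (ε • v) =
        D.closedLoop ^ k *ᵥ (ξ + ε • v) - D.closedLoop ^ k *ᵥ ξ := by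
      rw [Matrix.mulVec_add]; abel
    rw [h3]
    linarith [norm_sub_le (D.closedLoop ^ k *ᵥ (ξ + ε • v)) (D.closedLoop ^ k *ᵥ ξ)]
  have hpos : 0 < 2 * C + 1 := by linarith
  have ht : 0 < r / (2 * C + 1) := div_pos hr hpos
  have hmem : ∀ k, D.closedLoop ^ k *ᵥ ((r / (2 * C + 1) * ε) • v) ∈ D.XU := fun k => by
    refine hball ?_
    rw [mem_ball_zero_iff, mul_smul, Matrix.mulVec_smul, norm_smul, Real.norm_of_nonneg ht.le]
    calc r / (2 * C + 1) * ‖D.closedLoop ^ k *ᵥ (ε • v)‖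
        ≤ r / (2 * C + 1) * (2 * C) := mul_le_mul_of_nonneg_left (hb k) ht.le
      _ < r / (2 * C + 1) * (2 * C + 1) := mul_lt_mul_of_pos_left (by linarith) ht
      _ = r := div_mul_cancel₀ r hpos.ne'
  refine ⟨r / (2 * C + 1) * ε, mul_pos ht hε, ?_, hmem⟩
  have := (hmem 0).1
  rwa [pow_zero, Matrix.one_mulVec] at this

theorem dotProduct_self_pos {k : ℕ} {c : Fin k → ℝ} (hc : c ≠ 0) : 0 < c ⬝ᵥ c :=
  lt_of_le_of_ne (Finset.sum_nonneg fun i _ => mul_self_nonneg (c i)) fun h0 => hc (dotProduct_self_eq_zero.1 h0.symm)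

/-- A linear inequality that is valid on the terminal set is strict where the terminal constraints
are strict, unless it is `0 ≤ 0`. -/
theorem Standing.dotProduct_lt (h : D.Standing) {ξ : Fin n → ℝ} (hξ : D.TerminalStrict ξ)
    {c : Fin n → ℝ} {b : ℝ} (hcb : ∀ η ∈ D.terminalSet, c ⬝ᵥ η ≤ b) (h0 : c = 0 → 0 < b) :
    c ⬝ᵥ ξ < b := by
  by_cases hc : c = 0
  · simpa [hc] using h0 hc
  · obtain ⟨ε, hε, hmem⟩ := h.exists_add_smul_mem hξ c
    have := hcb _ hmem
    rw [dotProduct_add, dotProduct_smul, smul_eq_mul] at this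
    linarith [mul_pos hε (dotProduct_self_pos hc)]

theorem Standing.nX_lt (h : D.Standing) {ξ : Fin n → ℝ} (hξ : D.TerminalStrict ξ) (i : Fin qX) :
    D.nX i ⬝ᵥ ξ < D.bX i :=
  h.dotProduct_lt hξ (fun _ hη => hη.1 i) fun hc => absurd hc (h.nX_ne_zero i)

/-- The pulled-back normal may vanish; then strictness comes from `0` being interior to `U`. -/
theorem Standing.nU_lt (h : D.Standing) {ξ : Fin n → ℝ} (hξ : D.TerminalStrict ξ) (i : Fin qU) :
    D.nU i ⬝ᵥ (D.K *ᵥ ξ) < D.bU i := by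
  rw [Matrix.dotProduct_mulVec]
  refine h.dotProduct_lt hξ (fun η hη => ?_) fun _ => ?_
  · rw [← Matrix.dotProduct_mulVec]
    exact (mem_XU_of_mem_terminalSet hη).2 i
  · obtain ⟨ε, hε, hmem⟩ := exists_smul_mem_of_zero_mem_interior h.zero_mem_interior_U (D.nU i)
    have := hmem i
    rw [dotProduct_smul, smul_eq_mul] at this
    exact (mul_pos hε (dotProduct_self_pos (h.nU_ne_zero i))).trans_le this

/-- The pulled-back inequalities are valid on the terminal set by invariance. A normal may be
annihilated if the closed loop is singular; then positivity of `bT i` is needed, which follows from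
the terminal set being absorbing. -/
theorem Standing.terminalStrict_closedLoop (h : D.Standing) {ξ : Fin n → ℝ}
    (hξ : D.TerminalStrict ξ) : D.TerminalStrict (D.closedLoop *ᵥ ξ) := by
  intro i
  rw [Matrix.dotProduct_mulVec]
  refine h.dotProduct_lt hξ (fun η hη => ?_) fun _ => ?_
  · rw [← Matrix.dotProduct_mulVec]
    exact h.mem_terminalSet.1 (closedLoop_mem_terminalSet hη) i
  · obtain ⟨ε, hε, hmem⟩ := h.exists_smul_mem_terminalSet hξ (D.nT i)
    have := h.mem_terminalSet.1 hmem i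
    rw [dotProduct_smul, smul_eq_mul] at this
    exact (mul_pos hε (dotProduct_self_pos (h.nT_ne_zero i))).trans_le this

theorem Standing.feasible_iff (h : D.Standing) {x : Fin n → ℝ} {u : Fin N → Fin m → ℝ} :
    D.Feasible x u ↔
      (∀ k : Fin N, D.state x u k ∈ D.X ∧ u k ∈ D.U) ∧ D.state x u N ∈ D.terminalSet := by
  rw [h.mem_terminalSet]
  constructor
  · intro hf
    refine ⟨fun k => ⟨fun i => ?_, fun i => ?_⟩, fun i => ?_⟩
    · exact sub_nonpos.1 (hf (Sum.inl (k, Sum.inl i)))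
    · exact sub_nonpos.1 (hf (Sum.inl (k, Sum.inr i)))
    · exact sub_nonpos.1 (hf (Sum.inr i))
  · rintro ⟨hk, hT⟩ (⟨k, i | i⟩ | i)
    · exact sub_nonpos.2 ((hk k).1 i)
    · exact sub_nonpos.2 ((hk k).2 i)
    · exact sub_nonpos.2 (hT i)

/-! ### Extension of the horizon by one stage -/

variable (D) in
/-- Extension of an input sequence by the feedback of the unconstrained regulator. -/
noncomputable def extend (x : Fin n → ℝ) (u : Fin N → Fin m → ℝ) : Fin (N + 1) → Fin m → ℝ :=
  Fin.snoc (α := fun _ => Fin m → ℝ) u (D.K *ᵥ D.state x u N)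

theorem extend_castSucc (x : Fin n → ℝ) (u : Fin N → Fin m → ℝ) (k : Fin N) :
    D.extend x u k.castSucc = u k := Fin.snoc_castSucc (α := fun _ => Fin m → ℝ) _ _ k

theorem extend_last (x : Fin n → ℝ) (u : Fin N → Fin m → ℝ) :
    D.extend x u (Fin.last N) = D.K *ᵥ D.state x u N :=
  Fin.snoc_last (α := fun _ => Fin m → ℝ) _ _

theorem state_init (x : Fin n → ℝ) (v : Fin (N + 1) → Fin m → ℝ) {k : ℕ} (hk : k ≤ N) :
    D.state x (fun j : Fin N => v j.castSucc) k = D.state x v k := by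
  induction k with
  | zero => rfl
  | succ k ih =>
    have hk' : k < N := hk
    rw [state, state, ih hk'.le, dif_pos hk', dif_pos (hk'.trans N.lt_succ_self)]
    rfl

theorem state_extend (x : Fin n → ℝ) (u : Fin N → Fin m → ℝ) (k : ℕ) :
    D.state x (D.extend x u) k = D.state x u k := by
  have hle : ∀ {k}, k ≤ N → D.state x (D.extend x u) k = D.state x u k := fun hk => by
    rw [← state_init x _ hk]
    simp only [extend_castSucc]
  rcases le_total k N with hk | hk
  · exact hle hk
  · induction k, hk using Nat.le_induction with
    | base => exact hle le_rfl
    | succ k hk ih =>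
      rw [state, state, ih, dif_neg (not_lt.2 hk)]
      rcases hk.eq_or_lt with rfl | hk
      · rw [dif_pos N.lt_succ_self]
        congr 2
        exact extend_last x u
      · rw [dif_neg (by omega)]

theorem input_extend (x : Fin n → ℝ) (u : Fin N → Fin m → ℝ) (k : ℕ) :
    D.input x (D.extend x u) k = D.input x u k := by
  simp only [input, state_extend]
  rcases lt_trichotomy k N with hk | rfl | hk
  · rw [dif_pos hk, dif_pos (hk.trans N.lt_succ_self)]
    exact extend_castSucc x u ⟨k, hk⟩
  · rw [dif_neg (lt_irrefl _), dif_pos k.lt_succ_self]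
    exact extend_last x u
  · rw [dif_neg (by omega), dif_neg (by omega)]

/-- The bilinear form of completion of squares: the last stage contributes only through the
deviations from the regulator. -/
theorem Standing.bil_succ (h : D.Standing) (x : Fin n → ℝ) (v : Fin (N + 1) → Fin m → ℝ)
    (y : Fin n → ℝ) (w : Fin (N + 1) → Fin m → ℝ) :
    D.bil x v y w = D.bil x (fun j : Fin N => v j.castSucc) y (fun j : Fin N => w j.castSucc) +
      (v (Fin.last N) - D.K *ᵥ D.state x v N) ⬝ᵥ
        (D.gainWeight *ᵥ (w (Fin.last N) - D.K *ᵥ D.state y w N)) := by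
  have hs : ∀ (z : Fin n → ℝ) (p : Fin (N + 1) → Fin m → ℝ), D.state z p (N + 1) =
      D.A *ᵥ D.state z p N + D.B *ᵥ p (Fin.last N) := fun z p => by
    rw [state, dif_pos N.lt_succ_self]; rfl
  have h1 := h.stage_identity (D.state x v N) (D.state y w N) (v (Fin.last N)) (w (Fin.last N))
  rw [bil, bil, Fin.sum_univ_castSucc, hs, hs]
  simp only [state_init _ _ le_rfl, state_init _ _ (Fin.is_lt _).le, Fin.val_castSucc, Fin.val_last]
  linarith

theorem lhs_init (x : Fin n → ℝ) (v : Fin (N + 1) → Fin m → ℝ) (k : Fin N) (c : Fin qX ⊕ Fin qU) :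
    D.lhs x v (Sum.inl (k.castSucc, c)) =
      D.lhs x (fun j : Fin N => v j.castSucc) (Sum.inl (k, c)) := by
  rcases c with i | i <;> simp only [lhs, state_init x v k.2.le, Fin.val_castSucc]

theorem residual_init (x : Fin n → ℝ) (v : Fin (N + 1) → Fin m → ℝ) (k : Fin N)
    (c : Fin qX ⊕ Fin qU) :
    D.residual x v (Sum.inl (k.castSucc, c)) =
      D.residual x (fun j : Fin N => v j.castSucc) (Sum.inl (k, c)) := by
  rw [residual_eq, residual_eq, lhs_init]
  rcases c with i | i <;> rfl

/-- The terminal set is exactly the part of `XU` that the closed loop maps into the terminal set, so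
the new stage neither loses nor adds a condition. -/
theorem Standing.feasible_extend_iff (h : D.Standing) {x : Fin n → ℝ} {u : Fin N → Fin m → ℝ} :
    D.Feasible x (D.extend x u) ↔ D.Feasible x u := by
  have hs : D.state x u (N + 1) = D.closedLoop *ᵥ D.state x u N := by
    rw [state, dif_neg (lt_irrefl N), closedLoop_mulVec]
  rw [h.feasible_iff, h.feasible_iff, Fin.forall_fin_succ',
    mem_terminalSet_iff (ξ := D.state x u N)]
  simp only [state_extend, extend_castSucc, extend_last, Fin.val_castSucc, Fin.val_last, hs, XU,
    Set.mem_ofPred_eq, and_assoc]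

/-- The constraints in `a`, which are stage constraints, for a horizon prolonged by one stage. -/
def extendSet (a : Set (Constraint qX qU qT N)) : Set (Constraint qX qU qT (N + 1)) :=
  {i | ∃ k c, Sum.inl (k, c) ∈ a ∧ i = Sum.inl (Fin.castSucc k, c)}

theorem terminalInactive_extendSet (a : Set (Constraint qX qU qT N)) :
    TerminalInactive (extendSet a) := by
  rintro i ⟨k, c, -, hi⟩
  cases hi

/-- The extended input has zero deviation in the last stage, so the first-order change of the cost
depends only on the first `N` inputs. -/
theorem Standing.primalKKT_extend (h : D.Standing) {a : Set (Constraint qX qU qT N)}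
    (ha : TerminalInactive a) {x : Fin n → ℝ} {u : Fin N → Fin m → ℝ}
    (hu : D.PrimalKKT a x u) : D.PrimalKKT (extendSet a) x (D.extend x u) := by
  refine ⟨h.feasible_extend_iff.2 hu.1, ?_, fun d hd => ?_⟩
  · rintro _ ⟨k, c, hkc, rfl⟩
    rw [residual_init]
    simp only [extend_castSucc]
    exact hu.2.1 _ hkc
  · rw [h.bil_succ, extend_last, state_extend, sub_self, zero_dotProduct, add_zero]
    simp only [extend_castSucc]
    refine hu.2.2 _ ?_
    rintro (⟨k, c⟩ | i) hi
    · rw [← lhs_init]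
      exact hd _ ⟨k, c, hi, rfl⟩
    · exact absurd hi (ha i)

theorem state_zero_zero (k : ℕ) : D.state 0 (0 : Fin N → Fin m → ℝ) k = 0 := by
  simpa using D.state_smul (N := N) 0 0 0 k

theorem Standing.primalKKT_of_extendSet (h : D.Standing) {a : Set (Constraint qX qU qT N)}
    (ha : TerminalInactive a) {x : Fin n → ℝ} {v : Fin (N + 1) → Fin m → ℝ}
    (hv : D.PrimalKKT (extendSet a) x v) : ∃ u, D.PrimalKKT a x u := by
  set u : Fin N → Fin m → ℝ := fun j => v j.castSucc with hu
  have hinit : ∀ (d : Fin N → Fin m → ℝ) (e : Fin m → ℝ),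
      (fun j : Fin N => Fin.snoc (α := fun _ => Fin m → ℝ) d e j.castSucc) = d := fun d e => by
    funext j; exact Fin.snoc_castSucc (α := fun _ => Fin m → ℝ) _ _ j
  set e := v (Fin.last N) - D.K *ᵥ D.state x v N with he
  have he0 : e = 0 := by
    by_contra hne
    -- No constraint of `extendSet a` involves the last input, so it may be moved freely by `-e`.
    -- Definiteness of `gainWeight` then forces `e = 0`.
    have h1 := hv.2.2 (Fin.snoc (α := fun _ => Fin m → ℝ) (0 : Fin N → Fin m → ℝ) (-e)) (by
      rintro _ ⟨k, c, -, rfl⟩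
      rw [lhs_init, hinit]
      have := D.lhs_smul 0 0 (0 : Fin N → Fin m → ℝ) (Sum.inl (k, c))
      rw [smul_zero, smul_zero, zero_mul] at this
      exact this.le)
    have h2 := D.bil_smul_right x u 0 0 0
    have h3 := h.gainWeight_posDef.dotProduct_mulVec_pos hne
    rw [smul_zero, smul_zero, zero_mul] at h2
    rw [h.bil_succ, ← state_init 0 _ le_rfl, hinit, state_zero_zero, Matrix.mulVec_zero, sub_zero,
      Fin.snoc_last, ← he, ← hu, h2, Matrix.mulVec_neg, dotProduct_neg] at h1
    simp only [star_trivial] at h3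
    linarith
  have hv' : v = D.extend x u := by
    funext k
    induction k using Fin.lastCases with
    | last => rw [extend_last, hu, state_init x v le_rfl]; exact sub_eq_zero.1 he0
    | cast k => rw [extend_castSucc]
  refine ⟨u, h.feasible_extend_iff.1 (hv' ▸ hv.1), ?_, fun d hd => ?_⟩
  · rintro (⟨k, c⟩ | i) hi
    · rw [← residual_init]
      exact hv.2.1 _ ⟨k, c, hi, rfl⟩
    · exact absurd hi (ha i)
  · have h1 := hv.2.2 (Fin.snoc (α := fun _ => Fin m → ℝ) d 0) (by
      rintro _ ⟨k, c, hkc, rfl⟩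
      rw [lhs_init, hinit]
      exact hd _ hkc)
    rwa [h.bil_succ, hinit, ← he, he0, zero_dotProduct, add_zero] at h1

theorem Standing.setOf_primalKKT_extendSet (h : D.Standing) {a : Set (Constraint qX qU qT N)}
    (ha : TerminalInactive a) :
    {x | ∃ v, D.PrimalKKT (extendSet a) x v} = {x | ∃ u, D.PrimalKKT a x u} := by
  ext x
  exact ⟨fun ⟨_, hv⟩ => h.primalKKT_of_extendSet ha hv, fun ⟨_, hu⟩ => ⟨_, h.primalKKT_extend ha hu⟩⟩

theorem Standing.isOptimal_extend (h : D.Standing) {x : Fin n → ℝ} {u : Fin N → Fin m → ℝ}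
    (hu : D.IsOptimal x u) (hT : D.TerminalStrict (D.state x u N)) :
    D.IsOptimal x (D.extend x u) :=
  h.isOptimal_of_primalKKT (h.primalKKT_extend
    (fun i hi => (hT i).ne (sub_eq_zero.1 hi)) (h.primalKKT_of_isOptimal hu))

theorem Standing.isActiveSet_extendSet (h : D.Standing) {a : Set (Constraint qX qU qT N)}
    (ha : D.IsActiveSet N a) (hT : TerminalInactive a) : D.IsActiveSet (N + 1) (extendSet a) := by
  obtain ⟨x, u, hu, rfl⟩ := ha
  have hstrict : D.TerminalStrict (D.state x u N) := fun i =>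
    lt_of_le_of_ne (sub_nonpos.1 (hu.1 (Sum.inr i))) fun he => hT i (sub_eq_zero.2 he)
  have hstrict' := h.terminalStrict_closedLoop hstrict
  -- Old constraints keep their residuals. Those of the added stage and the new terminal ones are
  -- strict because `x(N)` and its closed-loop image are.
  refine ⟨x, _, h.isOptimal_extend hu hstrict, Set.Subset.antisymm ?_ ?_⟩
  · rintro _ ⟨k, c, hkc, rfl⟩
    change D.residual x (D.extend x u) _ = 0
    rw [residual_init]
    simp only [extend_castSucc]
    exact hkc
  · rintro (⟨k, c⟩ | i) hi
    · change D.residual x (D.extend x u) _ = 0 at hi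
      induction k using Fin.lastCases with
      | last =>
        rcases c with i | i
        · rw [residual, state_extend, Fin.val_last] at hi
          exact absurd (sub_eq_zero.1 hi) (h.nX_lt hstrict i).ne
        · rw [residual, extend_last] at hi
          exact absurd (sub_eq_zero.1 hi) (h.nU_lt hstrict i).ne
      | cast k =>
        rw [residual_init] at hi
        simp only [extend_castSucc] at hi
        exact ⟨k, c, hi, rfl⟩
    · change D.residual x (D.extend x u) _ = 0 at hi
      rw [residual, state_extend, state, dif_neg (lt_irrefl N), ← closedLoop_mulVec] at hi
      exact absurd (sub_eq_zero.1 hi) (hstrict' i).ne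

/-- Every active set without terminal constraints is persistent. -/
theorem Standing.isPersistent (h : D.Standing) {a : Set (Constraint qX qU qT N)}
    (ha : D.IsActiveSet N a) (hT : TerminalInactive a) : D.IsPersistent N (D.polytope N a) := by
  have key : ∀ l : ℕ, ∃ a' : Set (Constraint qX qU qT (N + l)), D.IsActiveSet (N + l) a' ∧
      TerminalInactive a' ∧
      {x | ∃ v, D.PrimalKKT a' x v} = {x | ∃ u, D.PrimalKKT a x u} ∧
      ∀ x u, D.PrimalKKT a x u → ∃ v, D.PrimalKKT a' x v ∧
        ∀ k, D.input x u k = D.input x v k ∧ D.state x u k = D.state x v k := by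
    intro l
    induction l with
    | zero => exact ⟨a, ha, hT, rfl, fun x u hu => ⟨u, hu, fun k => ⟨rfl, rfl⟩⟩⟩
    | succ l ih =>
      obtain ⟨a', ha', hT', hset, hsol⟩ := ih
      refine ⟨extendSet a', h.isActiveSet_extendSet ha' hT', terminalInactive_extendSet a',
        (h.setOf_primalKKT_extendSet hT').trans hset, fun x u hu => ?_⟩
      obtain ⟨v, hv, hk⟩ := hsol x u hu
      refine ⟨D.extend x v, h.primalKKT_extend hT' hv, fun k => ?_⟩
      rw [input_extend, state_extend]
      exact hk k
  intro l
  obtain ⟨a', ha', -, hset, hsol⟩ := key l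
  refine ⟨⟨a', ha', ?_⟩, fun x hx => ?_⟩
  · rw [h.polytope_eq, h.polytope_eq, hset]
  · obtain ⟨u, hu⟩ := h.polytope_subset a hx
    obtain ⟨v, hv, hk⟩ := hsol x u hu
    exact ⟨u, v, h.isOptimal_of_primalKKT hu, h.isOptimal_of_primalKKT hv, hk⟩

/-- Since persistence is automatic, only strictness at stage `N` remains to be checked. -/
theorem Standing.mem_persistentRegion_iff (h : D.Standing) {x : Fin n → ℝ} :
    x ∈ D.persistentRegion N ↔
      ∃ u : Fin N → Fin m → ℝ, D.IsOptimal x u ∧ D.TerminalStrict (D.state x u N) := by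
  constructor
  · rintro ⟨a, ⟨-, hT, -⟩, u, hu, rfl⟩
    exact ⟨u, hu, fun i =>
      lt_of_le_of_ne (sub_nonpos.1 (hu.1 (Sum.inr i))) fun he => hT i (sub_eq_zero.2 he)⟩
  · rintro ⟨u, hu, hT⟩
    have hT' : TerminalInactive {i | D.residual x u i = 0} := fun i hi =>
      (hT i).ne (sub_eq_zero.1 hi)
    have ha : D.IsActiveSet N {i | D.residual x u i = 0} := ⟨x, u, hu, rfl⟩
    exact ⟨_, ⟨ha, hT', h.isPersistent ha hT'⟩, u, hu, rfl⟩

theorem Standing.openPersistentRegion_subset (h : D.Standing) :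
    D.openPersistentRegion N ⊆ D.persistentRegion N :=
  fun _ ⟨a, ha, hx⟩ => ⟨a, ha, h.hasActiveSet_of_mem_polytope ha.1 hx⟩

theorem Standing.persistentRegion_subset_closure (h : D.Standing) :
    D.persistentRegion N ⊆ closure (D.openPersistentRegion N) :=
  fun _ ⟨a, ha, hx⟩ =>
    have hsub : D.polytope N a ⊆ D.openPersistentRegion N := fun _ hy => ⟨a, ha, hy⟩
    closure_mono hsub (h.mem_closure_polytope hx)

theorem persistentRegion_subset_feasibleSet : D.persistentRegion N ⊆ D.feasibleSet N :=
  fun _ ⟨_, _, u, hu, _⟩ => ⟨u, hu⟩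

/-! ### Positive invariance -/

theorem state_tail (x : Fin n → ℝ) (v : Fin (N + 1) → Fin m → ℝ) (k : ℕ) :
    D.state (D.state x v 1) (fun j : Fin N => v j.succ) k = D.state x v (k + 1) := by
  induction k with
  | zero => rfl
  | succ k ih =>
    rw [D.state_succ _ _ k, D.state_succ _ _ (k + 1), input, input, ih]
    by_cases hk : k < N
    · rw [dif_pos hk, dif_pos (Nat.succ_lt_succ hk)]; rfl
    · rw [dif_neg hk, dif_neg (by omega)]

theorem cost_tail (x : Fin n → ℝ) (v : Fin (N + 1) → Fin m → ℝ) :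
    D.cost x v = 1 / 2 * (x ⬝ᵥ (D.Q *ᵥ x) + v 0 ⬝ᵥ (D.R *ᵥ v 0)) +
      D.cost (D.state x v 1) (fun j : Fin N => v j.succ) := by
  rw [cost, cost, Fin.sum_univ_succ]
  simp only [state_tail, Fin.val_succ, Fin.val_zero, state_zero]
  ring

theorem Standing.feasible_tail_iff (h : D.Standing) {x : Fin n → ℝ}
    {v : Fin (N + 1) → Fin m → ℝ} :
    D.Feasible x v ↔ (x ∈ D.X ∧ v 0 ∈ D.U) ∧
      D.Feasible (D.state x v 1) (fun j : Fin N => v j.succ) := by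
  rw [h.feasible_iff, h.feasible_iff, Fin.forall_fin_succ]
  simp only [state_tail, Fin.val_succ, Fin.val_zero, state_zero, and_assoc]

/-- The principle of optimality. -/
theorem Standing.isOptimal_tail (h : D.Standing) {x : Fin n → ℝ} {v : Fin (N + 1) → Fin m → ℝ}
    (hv : D.IsOptimal x v) : D.IsOptimal (D.state x v 1) (fun j : Fin N => v j.succ) := by
  have hf := h.feasible_tail_iff.1 hv.1
  refine ⟨hf.2, fun w hw => ?_⟩
  -- A competitor for the tail is prefixed with the same first input, so both problems pass through
  -- the same state at time `1`.
  have h1 : D.state x (Fin.cons (α := fun _ => Fin m → ℝ) (v 0) w) 1 = D.state x v 1 := by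
    simp [state]
  have h2 := hv.2 (Fin.cons (α := fun _ => Fin m → ℝ) (v 0) w) (by
    rw [h.feasible_tail_iff, h1]
    exact ⟨hf.1, hw⟩)
  rw [cost_tail, cost_tail x (Fin.cons _ _), h1] at h2
  simp only [Fin.cons_zero, Fin.cons_succ] at h2
  linarith

theorem Standing.state_mem_persistentRegion (h : D.Standing) (k : ℕ) :
    ∀ (x : Fin n → ℝ) (u : Fin N → Fin m → ℝ), D.IsOptimal x u →
      D.TerminalStrict (D.state x u N) → D.state x u k ∈ D.persistentRegion N := by
  induction k with
  | zero => exact fun x u hu hT => h.mem_persistentRegion_iff.2 ⟨u, hu, hT⟩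
  | succ k ih =>
    intro x u hu hT
    -- Appending a stage and dropping the first gives an optimal solution with horizon `N` from
    -- `x(1)`, ending in the closed-loop image of the old terminal state.
    have h1 := ih _ _ (h.isOptimal_tail (h.isOptimal_extend hu hT)) (by
      rw [state_tail, state_extend, state, dif_neg (lt_irrefl N), ← closedLoop_mulVec]
      exact h.terminalStrict_closedLoop hT)
    rwa [state_tail, state_extend] at h1

/-- An open set on which the active set is constant lies in the open persistent region. -/
theorem Standing.mem_openPersistentRegion {n m qX qU qT : ℕ} {D : OCP n m qX qU qT} {N : ℕ}
    (h : D.Standing) {a : Set (Constraint qX qU qT N)} (hT : TerminalInactive a)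
    {W : Set (Fin n → ℝ)} (hW : IsOpen W) (ha : ∀ x ∈ W, D.HasActiveSet N x a) {x : Fin n → ℝ}
    (hx : x ∈ W) : x ∈ D.openPersistentRegion N := by
  have hact : D.IsActiveSet N a := ⟨x, ha x hx⟩
  refine ⟨a, ⟨hact, hT, h.isPersistent hact hT⟩, ?_⟩
  rw [h.polytope_eq]
  refine interior_subset_intrinsicInterior (mem_interior.2 ⟨W, fun y hy => ?_, hW, hx⟩)
  obtain ⟨u, hu, rfl⟩ := ha y hy
  exact ⟨u, h.primalKKT_of_isOptimal hu⟩

/-! ### A system with a persistent region that is not convex -/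

/-- A second-order system with the gain `K = (1, 0)`, whose terminal set is the square
`[-1, 1] × [-1, 1]`. -/
noncomputable def planarExample : OCP 2 1 4 2 4 where
  A := !![-1 / 4, 1; 1, 0]
  B := !![1 / 4; -1 / 2]
  Q := !![7 / 4, 1; 1, 1]
  R := !![1]
  P := !![4, 2; 2, 5]
  nX := ![![1, 0], ![-1, 0], ![0, 1], ![0, -1]]
  bX := fun _ => 2
  nU := ![![1], ![-1]]
  bU := fun _ => 1
  nT := ![![1, 0], ![-1, 0], ![0, 1], ![0, -1]]
  bT := fun _ => 1

namespace planarExample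

/-! ### Gain, constraint sets and standing assumptions of the example -/

theorem inv_weight : (planarExample.Bᵀ * planarExample.P * planarExample.B + planarExample.R)⁻¹ =
    !![1 / 2] := by
  refine Matrix.inv_eq_right_inv ?_
  ext i j
  fin_cases i; fin_cases j
  simp [planarExample, Matrix.mul_apply, Fin.sum_univ_succ]
  norm_num

theorem K_eq : planarExample.K = !![1, 0] := by
  rw [K, inv_weight]
  ext i j
  fin_cases i
  fin_cases j <;>
    simp [planarExample, Matrix.mul_apply, Matrix.vecMul, dotProduct, Fin.sum_univ_two]
  norm_num

theorem K_mulVec (ξ : Fin 2 → ℝ) : planarExample.K *ᵥ ξ = ![ξ 0] := by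
  rw [K_eq]
  ext i
  fin_cases i
  simp [Matrix.mulVec, dotProduct, Fin.sum_univ_succ]

theorem closedLoop_eq : planarExample.closedLoop = !![0, 1; 1 / 2, 0] := by
  rw [closedLoop, K_eq]
  ext i j
  fin_cases i <;> fin_cases j <;>
    simp [planarExample] <;> norm_num

theorem closedLoop_mulVec_eq (ξ : Fin 2 → ℝ) :
    planarExample.closedLoop *ᵥ ξ = ![ξ 1, 1 / 2 * ξ 0] := by
  rw [closedLoop_eq]
  ext i
  fin_cases i <;> simp [Matrix.mulVec, dotProduct, Fin.sum_univ_succ]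

theorem mem_X {ξ : Fin 2 → ℝ} : ξ ∈ planarExample.X ↔
    (ξ 0 ≤ 2 ∧ -2 ≤ ξ 0) ∧ ξ 1 ≤ 2 ∧ -2 ≤ ξ 1 := by
  change (∀ i, planarExample.nX i ⬝ᵥ ξ ≤ planarExample.bX i) ↔ _
  simp [planarExample, Fin.forall_fin_succ, dotProduct, Fin.sum_univ_succ, and_assoc,
    neg_le (b := (2 : ℝ))]

theorem mem_U {μ : Fin 1 → ℝ} : μ ∈ planarExample.U ↔ μ 0 ≤ 1 ∧ -1 ≤ μ 0 := by
  change (∀ i, planarExample.nU i ⬝ᵥ μ ≤ planarExample.bU i) ↔ _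
  simp [planarExample, Fin.forall_fin_succ, dotProduct, neg_le (b := (1 : ℝ))]

theorem terminal_iff {ξ : Fin 2 → ℝ} : (∀ i, planarExample.nT i ⬝ᵥ ξ ≤ planarExample.bT i) ↔
    (ξ 0 ≤ 1 ∧ -1 ≤ ξ 0) ∧ ξ 1 ≤ 1 ∧ -1 ≤ ξ 1 := by
  simp [planarExample, Fin.forall_fin_succ, dotProduct, Fin.sum_univ_succ, and_assoc,
    neg_le (b := (1 : ℝ))]

theorem terminalStrict_iff {ξ : Fin 2 → ℝ} : planarExample.TerminalStrict ξ ↔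
    (ξ 0 < 1 ∧ -1 < ξ 0) ∧ ξ 1 < 1 ∧ -1 < ξ 1 := by
  simp [TerminalStrict, planarExample, Fin.forall_fin_succ, dotProduct, Fin.sum_univ_succ,
    and_assoc, neg_lt (b := (1 : ℝ))]

theorem mem_XU {ξ : Fin 2 → ℝ} : ξ ∈ planarExample.XU ↔
    (ξ 0 ≤ 1 ∧ -1 ≤ ξ 0) ∧ ξ 1 ≤ 2 ∧ -2 ≤ ξ 1 := by
  simp only [XU, Set.mem_ofPred_eq, mem_X, K_mulVec, mem_U, Matrix.cons_val_zero]
  constructor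
  · rintro ⟨⟨-, h⟩, h'⟩
    exact ⟨h', h⟩
  · rintro ⟨⟨h1, h2⟩, h⟩
    exact ⟨⟨⟨by linarith, by linarith⟩, h⟩, h1, h2⟩

theorem terminal_eq :
    {ξ | ∀ i, planarExample.nT i ⬝ᵥ ξ ≤ planarExample.bT i} = planarExample.terminalSet := by
  ext ξ
  rw [Set.mem_ofPred_eq, terminal_iff]
  constructor
  · intro h
    have hk : ∀ k : ℕ, (((planarExample.closedLoop ^ k) *ᵥ ξ) 0 ≤ 1 ∧
        -1 ≤ ((planarExample.closedLoop ^ k) *ᵥ ξ) 0) ∧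
        ((planarExample.closedLoop ^ k) *ᵥ ξ) 1 ≤ 1 ∧
        -1 ≤ ((planarExample.closedLoop ^ k) *ᵥ ξ) 1 := by
      intro k
      induction k with
      | zero => simpa using h
      | succ k ih =>
        rw [pow_succ', ← Matrix.mulVec_mulVec, closedLoop_mulVec_eq]
        simp only [Matrix.cons_val_zero, Matrix.cons_val_one]
        -- The closed loop swaps the coordinates and halves one of them, so the unit square is
        -- invariant.
        exact ⟨ih.2, by linarith [ih.1.1], by linarith [ih.1.2]⟩
    refine ⟨mem_X.2 ⟨⟨?_, ?_⟩, ?_, ?_⟩, fun k => mem_XU.2 ⟨(hk k).1, ?_, ?_⟩⟩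
    · linarith [h.1.1]
    · linarith [h.1.2]
    · linarith [h.2.1]
    · linarith [h.2.2]
    · exact (hk k).2.1.trans one_le_two
    · exact le_trans (by norm_num) (hk k).2.2
  · intro h
    have h0 := mem_XU.1 (mem_XU_of_mem_terminalSet h)
    -- The input bound one step later is what bounds the second coordinate by `1`.
    have h1 := mem_XU.1 (mem_XU_of_mem_terminalSet (closedLoop_mem_terminalSet h))
    rw [closedLoop_mulVec_eq] at h1
    simp only [Matrix.cons_val_zero] at h1
    exact ⟨h0.1, h1.1⟩

theorem controllable : planarExample.controllabilityMatrix.rank = 2 := by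
  have hli : LinearIndependent ℝ planarExample.controllabilityMatrix.row := by
    rw [Fintype.linearIndependent_iff]
    intro g hg
    have h0 := congrFun hg (0, 0)
    have h1 := congrFun hg (1, 0)
    simp [controllabilityMatrix, planarExample, Fin.sum_univ_two, Matrix.row, Matrix.mul_apply]
      at h0 h1
    intro i
    fin_cases i
    · change g 0 = 0
      linarith
    · change g 1 = 0
      linarith
  simpa using hli.rank_matrix

theorem posSemidef_of_nonneg {M : Matrix (Fin 2) (Fin 2) ℝ} (hM : M 0 1 = M 1 0)
    (h : ∀ a b : ℝ, 0 ≤ M 0 0 * a ^ 2 + 2 * M 0 1 * a * b + M 1 1 * b ^ 2) : M.PosSemidef := by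
  refine Matrix.PosSemidef.of_dotProduct_mulVec_nonneg ?_ fun x => ?_
  · ext i j
    fin_cases i <;> fin_cases j <;> simp [hM]
  · have := h (x 0) (x 1)
    simp only [dotProduct, Matrix.mulVec, Fin.sum_univ_two, star_trivial]
    rw [← hM]
    linarith

theorem standing : planarExample.Standing where
  controllable := controllable
  Q_posSemidef := posSemidef_of_nonneg rfl fun a b => by
    simp only [planarExample, Matrix.of_apply, Matrix.cons_val_zero, Matrix.cons_val_one]
    nlinarith [sq_nonneg (a + b), sq_nonneg a]
  R_posDef := by
    have : planarExample.R = 1 := by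
      ext i j
      fin_cases i; fin_cases j
      simp [planarExample]
    rw [this]
    exact Matrix.PosDef.one
  P_posSemidef := posSemidef_of_nonneg rfl fun a b => by
    simp only [planarExample, Matrix.of_apply, Matrix.cons_val_zero, Matrix.cons_val_one]
    nlinarith [sq_nonneg (2 * a + b), sq_nonneg b]
  riccati := by
    rw [add_comm planarExample.R, inv_weight]
    ext i j
    fin_cases i <;> fin_cases j <;>
      simp [planarExample, Matrix.mul_apply, Matrix.vecMul, dotProduct, Fin.sum_univ_two,
        Matrix.vecHead, Matrix.vecTail] <;> norm_num
  nX_ne_zero i h := by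
    have h0 := congrFun h 0
    have h1 := congrFun h 1
    fin_cases i <;> simp [planarExample] at h0 h1
  nU_ne_zero i h := by
    have h0 := congrFun h 0
    fin_cases i <;> simp [planarExample] at h0
  nT_ne_zero i h := by
    have h0 := congrFun h 0
    have h1 := congrFun h 1
    fin_cases i <;> simp [planarExample] at h0 h1
  X_compact := by
    have : planarExample.X = Set.Icc (fun _ => -2) fun _ => 2 := by
      ext ξ
      rw [mem_X, Set.mem_Icc, Pi.le_def, Pi.le_def, Fin.forall_fin_two, Fin.forall_fin_two]
      tauto
    rw [this]
    exact isCompact_Icc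
  U_compact := by
    have : planarExample.U = Set.Icc (fun _ => -1) fun _ => 1 := by
      ext ξ
      rw [mem_U, Set.mem_Icc, Pi.le_def, Pi.le_def, Fin.forall_fin_one, Fin.forall_fin_one]
      tauto
    rw [this]
    exact isCompact_Icc
  zero_mem_interior_X := by
    refine mem_interior.2 ⟨Metric.ball 0 1, fun ξ hξ => mem_X.2 ?_, Metric.isOpen_ball,
      Metric.mem_ball_self one_pos⟩
    rw [mem_ball_zero_iff] at hξ
    have h := fun i => abs_le.1 ((norm_le_pi_norm ξ i).trans hξ.le)
    refine ⟨⟨?_, ?_⟩, ?_, ?_⟩ <;> linarith [(h 0).1, (h 0).2, (h 1).1, (h 1).2]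
  zero_mem_interior_U := by
    refine mem_interior.2 ⟨Metric.ball 0 1, fun ξ hξ => mem_U.2 ?_, Metric.isOpen_ball,
      Metric.mem_ball_self one_pos⟩
    rw [mem_ball_zero_iff] at hξ
    have h := abs_le.1 ((norm_le_pi_norm ξ 0).trans hξ.le)
    exact ⟨h.2, h.1⟩
  terminal_eq := terminal_eq

/-! ### The example with horizon one -/

theorem state_one (x : Fin 2 → ℝ) (u : Fin 1 → Fin 1 → ℝ) : planarExample.state x u 1 =
    ![-1 / 4 * x 0 + x 1 + 1 / 4 * u 0 0, x 0 - 1 / 2 * u 0 0] := by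
  ext i
  fin_cases i
  · simp [state, planarExample, dotProduct, Fin.sum_univ_succ]
  · simp [state, planarExample, dotProduct, Fin.sum_univ_succ]
    ring

/-- Completion of squares with weight `R + Bᵀ P B = 2`: only the last square depends on the input.
-/
theorem cost_eq (x : Fin 2 → ℝ) (u : Fin 1 → Fin 1 → ℝ) : planarExample.cost x u =
    2 * x 0 ^ 2 + 2 * x 0 * x 1 + 5 / 2 * x 1 ^ 2 + (u 0 0 - x 0) ^ 2 := by
  rw [cost, state_one]
  simp [state, planarExample, Matrix.mulVec, dotProduct, Fin.sum_univ_succ]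
  ring

theorem feasible_iff {x : Fin 2 → ℝ} {u : Fin 1 → Fin 1 → ℝ} : planarExample.Feasible x u ↔
    x ∈ planarExample.X ∧ (u 0 0 ≤ 1 ∧ -1 ≤ u 0 0) ∧
      planarExample.state x u 1 ∈ planarExample.terminalSet := by
  rw [standing.feasible_iff, Fin.forall_fin_one, mem_U, and_assoc]
  rfl

theorem mem_terminalSet {ξ : Fin 2 → ℝ} : ξ ∈ planarExample.terminalSet ↔
    (ξ 0 ≤ 1 ∧ -1 ≤ ξ 0) ∧ ξ 1 ≤ 1 ∧ -1 ≤ ξ 1 := by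
  rw [standing.mem_terminalSet, terminal_iff]

/-- The unconstrained regulator is optimal if it is feasible. -/
theorem isOptimal_gain {x : Fin 2 → ℝ} (hx : planarExample.Feasible x (fun _ : Fin 1 => ![x 0])) :
    planarExample.IsOptimal x (fun _ : Fin 1 => ![x 0]) := by
  refine ⟨hx, fun v _ => ?_⟩
  rw [cost_eq, cost_eq]
  simp only [Matrix.cons_val_zero]
  linarith [sq_nonneg (v 0 0 - x 0)]

/-- The maximal input is optimal if it is feasible and the unconstrained regulator exceeds it. -/
theorem isOptimal_saturated {x : Fin 2 → ℝ}
    (hx : planarExample.Feasible x (fun _ : Fin 1 => ![(1 : ℝ)])) (h1 : 1 ≤ x 0) :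
    planarExample.IsOptimal x (fun _ : Fin 1 => ![(1 : ℝ)]) := by
  refine ⟨hx, fun v hv => ?_⟩
  have hv1 := (feasible_iff.1 hv).2.1.1
  rw [cost_eq, cost_eq]
  simp only [Matrix.cons_val_zero]
  nlinarith

theorem residual_state (x : Fin 2 → ℝ) (u : Fin 1 → Fin 1 → ℝ) (k : Fin 1) (i : Fin 4) :
    planarExample.residual x u (Sum.inl (k, Sum.inl i)) = planarExample.nX i ⬝ᵥ x - 2 := by
  rw [Subsingleton.elim k 0]; rfl

theorem residual_input (x : Fin 2 → ℝ) (u : Fin 1 → Fin 1 → ℝ) (k : Fin 1) (i : Fin 2) :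
    planarExample.residual x u (Sum.inl (k, Sum.inr i)) = planarExample.nU i ⬝ᵥ u 0 - 1 := by
  rw [Subsingleton.elim k 0]; rfl

theorem nX_lt {x : Fin 2 → ℝ} (h : (x 0 < 2 ∧ -2 < x 0) ∧ x 1 < 2 ∧ -2 < x 1) (i : Fin 4) :
    planarExample.nX i ⬝ᵥ x < 2 := by
  obtain ⟨⟨h1, h2⟩, h3, h4⟩ := h
  fin_cases i <;> simp [planarExample, dotProduct, Fin.sum_univ_succ] <;> linarith

/-- The interior of the terminal set, on which no constraint is active. -/
theorem hasActiveSet_empty {x : Fin 2 → ℝ} (h : (x 0 < 1 ∧ -1 < x 0) ∧ x 1 < 1 ∧ -1 < x 1) :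
    planarExample.HasActiveSet 1 x ∅ := by
  obtain ⟨⟨h1, h2⟩, h3, h4⟩ := h
  have hstrict : planarExample.TerminalStrict
      (planarExample.state x (fun _ : Fin 1 => ![x 0]) 1) := by
    rw [terminalStrict_iff, state_one]
    simp only [Matrix.cons_val_zero, Matrix.cons_val_one]
    refine ⟨⟨?_, ?_⟩, ?_, ?_⟩ <;> linarith
  refine ⟨_, isOptimal_gain (feasible_iff.2 ⟨mem_X.2 ?_, ?_,
    standing.mem_terminalSet_of_strict hstrict⟩), ?_⟩
  · refine ⟨⟨?_, ?_⟩, ?_, ?_⟩ <;> linarith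
  · simp only [Matrix.cons_val_zero]
    exact ⟨h1.le, h2.le⟩
  · refine (Set.eq_empty_of_forall_notMem ?_).symm
    rintro (⟨k, i | i⟩ | i) (hi : planarExample.residual _ _ _ = 0)
    · rw [residual_state] at hi
      have := nX_lt (x := x) ⟨⟨by linarith, by linarith⟩, by linarith, by linarith⟩ i
      linarith
    · rw [residual_input] at hi
      fin_cases i <;> simp [planarExample, dotProduct] at hi <;> linarith
    · exact (hstrict i).ne (sub_eq_zero.1 hi)

/-- A region in which only the upper input constraint is active. -/
theorem hasActiveSet_saturated {x : Fin 2 → ℝ} (h1 : 1 < x 0) (h2 : x 0 < 3 / 2)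
    (h3 : x 1 - 1 / 4 * x 0 < 3 / 4) (h4 : -5 / 4 < x 1 - 1 / 4 * x 0) :
    planarExample.HasActiveSet 1 x {Sum.inl (0, Sum.inr 0)} := by
  have hstrict : planarExample.TerminalStrict
      (planarExample.state x (fun _ : Fin 1 => ![(1 : ℝ)]) 1) := by
    rw [terminalStrict_iff, state_one]
    simp only [Matrix.cons_val_zero, Matrix.cons_val_one]
    refine ⟨⟨?_, ?_⟩, ?_, ?_⟩ <;> linarith
  refine ⟨_, isOptimal_saturated (feasible_iff.2 ⟨mem_X.2 ?_, ?_,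
    standing.mem_terminalSet_of_strict hstrict⟩) h1.le, ?_⟩
  · refine ⟨⟨?_, ?_⟩, ?_, ?_⟩ <;> linarith
  · norm_num
  · refine Set.Subset.antisymm ?_ ?_
    · rintro _ rfl
      change planarExample.residual _ _ _ = 0
      rw [residual_input]
      simp [planarExample, dotProduct]
    · rintro (⟨k, i | i⟩ | i) (hi : planarExample.residual _ _ _ = 0)
      · rw [residual_state] at hi
        have := nX_lt (x := x) ⟨⟨by linarith, by linarith⟩, by linarith, by linarith⟩ i
        linarith
      · rw [residual_input] at hi
        rw [Subsingleton.elim k 0]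
        fin_cases i
        · rfl
        · simp [planarExample, dotProduct] at hi
          norm_num at hi
      · exact absurd (sub_eq_zero.1 hi) (hstrict i).ne

theorem isOpen_setOf_lt {α : Type*} [TopologicalSpace α] {f g : α → ℝ} (hf : Continuous f)
    (hg : Continuous g) (a b c d : ℝ) :
    IsOpen {x | (a < f x ∧ f x < b) ∧ c < g x ∧ g x < d} :=
  (isOpen_Ioo.preimage hf).inter (isOpen_Ioo.preimage hg)

theorem left_mem : ![0, 19 / 20] ∈ planarExample.openPersistentRegion 1 := by
  refine standing.mem_openPersistentRegion (a := ∅)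
    (W := {x | (-1 < x 0 ∧ x 0 < 1) ∧ -1 < x 1 ∧ x 1 < 1}) (fun i hi => hi)
    (isOpen_setOf_lt (f := fun x : Fin 2 → ℝ => x 0) (g := fun x => x 1) (by fun_prop) (by fun_prop) _ _ _ _)
    (fun x hx => hasActiveSet_empty ⟨hx.1.symm, hx.2.symm⟩) ?_
  simp only [Set.mem_ofPred_eq, Matrix.cons_val_zero, Matrix.cons_val_one]
  norm_num

/-- The saturated input gives `x(1)` the first coordinate `19/20`, although `x 1` exceeds `1`. -/
theorem right_mem : ![7 / 5, 21 / 20] ∈ planarExample.openPersistentRegion 1 := by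
  refine standing.mem_openPersistentRegion (a := {Sum.inl (0, Sum.inr 0)})
    (W := {x | (1 < x 0 ∧ x 0 < 3 / 2) ∧
      -5 / 4 < x 1 - 1 / 4 * x 0 ∧ x 1 - 1 / 4 * x 0 < 3 / 4}) (fun i hi => by cases hi)
    (isOpen_setOf_lt (f := fun x : Fin 2 → ℝ => x 0) (g := fun x => x 1 - 1 / 4 * x 0)
      (by fun_prop) (by fun_prop) _ _ _ _)
    (fun x hx => hasActiveSet_saturated hx.1.1 hx.1.2 hx.2.2 hx.2.1) ?_
  simp only [Set.mem_ofPred_eq, Matrix.cons_val_zero, Matrix.cons_val_one]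
  norm_num

/-- The unsaturated regulator is optimal here, and its input `7/10` cancels the contribution of `x
0` to the first coordinate of `x(1)`, which therefore equals `1`: a terminal constraint is active.
-/
theorem middle_notMem : ![7 / 10, 1] ∉ planarExample.persistentRegion 1 := by
  intro hmem
  obtain ⟨u, hu, hT⟩ := standing.mem_persistentRegion_iff.1 hmem
  have hopt := isOptimal_gain (x := ![7 / 10, 1]) (by
    rw [feasible_iff, mem_X, mem_terminalSet, state_one]
    simp only [Matrix.cons_val_zero, Matrix.cons_val_one]
    norm_num)
  rw [standing.isOptimal_unique hu hopt, terminalStrict_iff, state_one] at hT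
  simp only [Matrix.cons_val_zero, Matrix.cons_val_one] at hT
  norm_num at hT

/-- No set between the two persistent regions is convex. -/
theorem not_convex {S : Set (Fin 2 → ℝ)} (h1 : planarExample.openPersistentRegion 1 ⊆ S)
    (h2 : S ⊆ planarExample.persistentRegion 1) : ¬ Convex ℝ S := by
  intro hS
  have h := hS (h1 left_mem) (h1 right_mem) (a := 1 / 2) (b := 1 / 2) (by norm_num) (by norm_num)
    (by norm_num)
  have he : (1 / 2 : ℝ) • ![0, 19 / 20] + (1 / 2 : ℝ) • ![7 / 5, 21 / 20] =
      ![(7 / 10 : ℝ), 1] := by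
    ext i
    fin_cases i <;> simp <;> norm_num
  rw [he] at h
  exact middle_notMem (h2 h)

end planarExample

end OCP

end ConstrainedLQR

theorem corollary3 :
    (∀ (n m qX qU qT : ℕ) (D : ConstrainedLQR.OCP n m qX qU qT), D.Standing → ∀ N : ℕ,
      -- positive invariance under the open-loop optimally controlled system
      (∀ x₀ ∈ D.persistentRegion N, ∀ u : Fin N → Fin m → ℝ, D.IsOptimal x₀ u →
        ∀ k : ℕ, D.state x₀ u k ∈ D.persistentRegion N) ∧
      -- the convex hull lies in the convex feasible set
      Convex ℝ (D.feasibleSet N) ∧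
      convexHull ℝ (D.persistentRegion N) ⊆ D.feasibleSet N ∧
      -- the region differs from the union of the relatively open polytopes in boundary points only
      D.openPersistentRegion N ⊆ D.persistentRegion N ∧
      D.persistentRegion N ⊆ closure (D.openPersistentRegion N)) ∧
    -- in general, the region is not convex
    (∃ (n m qX qU qT : ℕ) (D : ConstrainedLQR.OCP n m qX qU qT) (N : ℕ), D.Standing ∧ 1 ≤ N ∧
      ¬ Convex ℝ (D.persistentRegion N) ∧ ¬ Convex ℝ (D.openPersistentRegion N)) := by
  open ConstrainedLQR.OCP in
  refine ⟨fun n m qX qU qT D h N => ⟨fun x hx u hu k => ?_, h.convex_feasibleSet,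
    convexHull_min persistentRegion_subset_feasibleSet h.convex_feasibleSet,
    h.openPersistentRegion_subset, h.persistentRegion_subset_closure⟩,
    2, 1, 4, 2, 4, planarExample, 1, planarExample.standing, le_rfl,
    -- Both failures use the same midpoint: the endpoints lie in the smaller region, the midpoint
    -- outside the larger.
    planarExample.not_convex planarExample.standing.openPersistentRegion_subset subset_rfl,
    planarExample.not_convex subset_rfl planarExample.standing.openPersistentRegion_subset⟩
  obtain ⟨v, hv, hT⟩ := h.mem_persistentRegion_iff.1 hx
  obtain rfl := h.isOptimal_unique hu hv
  exact h.state_mem_persistentRegion k x u hu hT
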